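/- Let $n\ge 2$ be an integer, and let $U_{2n-1}$ be the Chebyshev polynomial of the second kind of degree $2n-1$. Since $U'_{2n-1}$ is even, $U'_{2n-1}(\sqrt{x})$ is a polynomial in $x$ with integer coefficients, of degree $n-1$. For a polynomial $p$ put $$(Sp)(z)=\frac12\int_{-z}^{z}p'(t)\,(x-t^2)\,dt ,$$ a polynomial in $x$ for each real $z$. Call a polynomial $J\in\mathbb{Z}[x]$ of degree $n-1$ with relatively prime coefficients a Jeff polynomial if there are nonzero rational numbers $C,A$ such that $$C\Bigl(\prod_{\zeta>0,\;U'_{2n-1}(\zeta)=0}(SU_{2n-1})(\zeta)\Bigr)^2=A\,J(x)^2 .$$ Then a Jeff polynomial $J$ exists and is unique up to sign; its roots are the numbers $\zeta^2-\frac{2}{(2n-1)(2n+1)}$, where $\zeta$ runs over the positive roots of $U'_{2n-1}$, all of them simple. Moreover: 1. $\mathrm{Disc}_x\,U'_{2n-1}(\sqrt{x})=3\,(2n+1)^{n-2}(2n-1)^{n-3}n^{n-3}2^{2n^2-3n-1}$. 2. If $n\neq 3$, the discriminants of $J(x)$ and of $U'_{2n-1}(\sqrt{x})$ have the same prime factors.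 3. If $n\ge 3$, the prime factors of $\mathrm{Disc}_x\,J$ are exactly $2$, $3$ and the prime factors of $n$, $2n-1$ and $2n+1$. -/

import Mathlib

open Polynomial

noncomputable section

/-- The derivative `U'_{2n-1}` of the Chebyshev polynomial of the second kind of index `2n - 1`,
over a commutative ring `R`. -/
def derivU (R : Type*) [CommRing R] (n : ℕ) : R[X] :=
  derivative (Chebyshev.U R (2 * (n : ℤ) - 1))

/-- The integer polynomial `U'_{2n-1}(√x)` in `x`: since `U'_{2n-1}` is even, it is
obtained from `U'_{2n-1}` by keeping the coefficients of the even powers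
(see `expand_derivUSqrt` and `aeval_derivUSqrt`). -/
def derivUSqrt (n : ℕ) : ℤ[X] :=
  contract 2 (derivU ℤ n)

/-- The value at the real numbers `z` and `x` of the integral transform `S` of a polynomial `p`:
`(Sp)(z) = (1/2) ∫_{-z}^{z} p'(t) (x - t²) dt`. -/
def integralTransform (p : ℝ[X]) (z x : ℝ) : ℝ :=
  (1 / 2) * ∫ t in (-z)..z, (derivative p).eval t * (x - t ^ 2)

/-- The finite set of the positive real roots of `U'_{2n-1}`. -/
def posRoots (n : ℕ) : Finset ℝ :=
  (derivU ℝ n).roots.toFinset.filter (fun ζ => 0 < ζ)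

/-- `J` is a Jeff polynomial for `n`: an integer polynomial of degree `n - 1` with relatively
prime coefficients such that, as polynomials in `x`, the square of
`∏ (S U_{2n-1})(ζ)`, over the positive roots `ζ` of `U'_{2n-1}`, is `J²` up to
nonzero rational factors. -/
def IsJeff (n : ℕ) (J : ℤ[X]) : Prop :=
  J.natDegree = n - 1 ∧ J.IsPrimitive ∧
    ∃ C A : ℚ, C ≠ 0 ∧ A ≠ 0 ∧ ∀ x : ℝ,
      (C : ℝ) * (∏ ζ ∈ posRoots n,
          integralTransform (Chebyshev.U ℝ (2 * (n : ℤ) - 1)) ζ x) ^ 2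
        = (A : ℝ) * (aeval x J) ^ 2

theorem chebyshevU_odd_comp_neg (n : ℕ) :
    (Chebyshev.U ℤ (2 * (n : ℤ) - 1)).comp (-X) = -Chebyshev.U ℤ (2 * (n : ℤ) - 1) := by
  rcases n with _ | k
  · simp
  · have h : (2 * ((k + 1 : ℕ) : ℤ) - 1) = ((2 * k + 1 : ℕ) : ℤ) := by push_cast; ring
    rw [h]
    refine Polynomial.funext fun x => ?_
    have h2 : ((2 * k + 1 : ℕ) : ℤ).negOnePow = -1 :=
      Int.negOnePow_odd _ ⟨k, by push_cast; ring⟩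
    rw [eval_comp, eval_neg, eval_X, Chebyshev.U_eval_neg, h2]
    simp

theorem derivU_comp_neg (n : ℕ) : (derivU ℤ n).comp (-X) = derivU ℤ n := by
  have h := congrArg derivative (chebyshevU_odd_comp_neg n)
  rw [derivative_comp] at h
  simpa [derivU] using h

theorem expand_derivUSqrt (n : ℕ) : expand ℤ 2 (derivUSqrt n) = derivU ℤ n := by
  ext k
  rw [coeff_expand (by norm_num), derivUSqrt]
  split_ifs with hk
  · rw [coeff_contract (by norm_num), Nat.div_mul_cancel hk]
  · have h := congrArg (fun q => coeff q k) (derivU_comp_neg n)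
    have hodd : Odd k := by rwa [← Nat.not_even_iff_odd, even_iff_two_dvd]
    have hX : (-X : ℤ[X]) = C (-1) * X := by simp
    simp only [hX, comp_C_mul_X_coeff, hodd.neg_one_pow] at h
    lia

theorem aeval_derivUSqrt (n : ℕ) {x : ℝ} (hx : 0 ≤ x) :
    aeval x (derivUSqrt n) = (derivU ℝ n).eval (Real.sqrt x) := by
  have h := expand_aeval 2 (derivUSqrt n) (Real.sqrt x)
  rw [Real.sq_sqrt hx, expand_derivUSqrt] at h
  rw [← h, derivU, derivU, aeval_def, ← eval_map, ← derivative_map, Chebyshev.map_U]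

end

open Polynomial

noncomputable section

/-! Write `U = U_{2n-1}`, `N = (2n-1)(2n+1)`, `P(x) = U'(√x)`. Everything rests on the Chebyshev
equation `(1-t²)U'' = 3tU' - NU`.

Discriminant. `P` has `n-1` simple positive roots `ζ²`. At a critical point the equation gives
`2ζ(1-ζ²)P'(ζ²) = -N U(ζ)`, so `∏ P'(ζ²)`, hence `Disc P`, follows from `∏ ζ²` and `∏ (1-ζ²)` (read
off from `P(0)` and `P(1)`) and from `∏ U(ζ)`. The last product is found by evaluating the resultant
of `U` and `U'` from both sides (`prod_eval_chebyshevU_sq`), since `|(1-η²)U'(η)| = 2n` at each zero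
`η` of `U`. This determines `(Disc P)²`; real-rootedness gives the sign.

Jeff polynomial. Integrating by parts with the same equation gives `(SU)(ζ) = U(ζ)(x + 2/N - ζ²)`,
so the product over `ζ` is a constant with rational square times `P(x + 2/N)`. By Gauss's lemma `J`
is, up to sign, the primitive part of `N^(n-1) P(x + 2/N)`.

Primes. Away from `2N`, passing from `P` to `J` changes the discriminant only by factors prime to
`p`. If `p ∣ 2N`, all nonconstant coefficients of `J` are divisible by `p`, so `p ∣ Disc J` once
`deg J ≥ 2`. For `n = 3` the factor `2n-1 = 5` has exponent zero in `Disc P` but still divides `Disc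
J`, whence the exception. -/

/-! ### Degrees, leading coefficients and special values -/

theorem two_mul_sub_one_eq_natCast {n : ℕ} (hn : 2 ≤ n) :
    2 * (n : ℤ) - 1 = ((2 * n - 1 : ℕ) : ℤ) := by lia

theorem natDegree_chebyshevU_odd {n : ℕ} (hn : 2 ≤ n) :
    (Chebyshev.U ℝ (2 * (n : ℤ) - 1)).natDegree = 2 * n - 1 := by
  rw [two_mul_sub_one_eq_natCast hn, Chebyshev.natDegree_U_natCast]

theorem leadingCoeff_chebyshevU_odd {n : ℕ} (hn : 2 ≤ n) :
    (Chebyshev.U ℝ (2 * (n : ℤ) - 1)).leadingCoeff = 2 ^ (2 * n - 1) := by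
  rw [two_mul_sub_one_eq_natCast hn, Chebyshev.leadingCoeff_U_natCast]

theorem eval_neg_chebyshevU_odd {n : ℕ} (x : ℝ) :
    (Chebyshev.U ℝ (2 * (n : ℤ) - 1)).eval (-x) = -(Chebyshev.U ℝ (2 * (n : ℤ) - 1)).eval x := by
  have h := congrArg (fun q => (q.map (Int.castRingHom ℝ)).eval x) (chebyshevU_odd_comp_neg n)
  simpa [map_comp, Chebyshev.map_U] using h

theorem map_derivU (n : ℕ) : (derivU ℤ n).map (Int.castRingHom ℝ) = derivU ℝ n := by
  rw [derivU, derivU, ← derivative_map, Chebyshev.map_U]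

/-- `U'_{2n-1}(√x)` as a real polynomial. -/
def derivUSqrtReal (n : ℕ) : ℝ[X] := (derivUSqrt n).map (Int.castRingHom ℝ)

theorem expand_derivUSqrtReal (n : ℕ) : expand ℝ 2 (derivUSqrtReal n) = derivU ℝ n := by
  rw [derivUSqrtReal, ← map_expand, expand_derivUSqrt, map_derivU]

theorem eval_derivUSqrtReal_sq (n : ℕ) (y : ℝ) :
    (derivUSqrtReal n).eval (y ^ 2) = (derivU ℝ n).eval y := by
  rw [← expand_derivUSqrtReal, expand_eval]

theorem eval_neg_derivU (n : ℕ) (x : ℝ) : (derivU ℝ n).eval (-x) = (derivU ℝ n).eval x := by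
  rw [← eval_derivUSqrtReal_sq, neg_sq, eval_derivUSqrtReal_sq]

theorem natDegree_derivU {n : ℕ} (hn : 2 ≤ n) : (derivU ℝ n).natDegree = 2 * (n - 1) := by
  rw [derivU, natDegree_derivative, natDegree_chebyshevU_odd hn]
  lia

theorem natDegree_derivUSqrtReal {n : ℕ} (hn : 2 ≤ n) : (derivUSqrtReal n).natDegree = n - 1 := by
  have h := natDegree_expand 2 (derivUSqrtReal n)
  rw [expand_derivUSqrtReal, natDegree_derivU hn] at h
  lia

theorem leadingCoeff_derivU {n : ℕ} (hn : 2 ≤ n) :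
    (derivU ℝ n).leadingCoeff = (2 * n - 1) * 2 ^ (2 * n - 1) := by
  have h : 2 * (n - 1) + 1 = 2 * n - 1 := by lia
  rw [leadingCoeff, natDegree_derivU hn, derivU, coeff_derivative, h,
    ← leadingCoeff_chebyshevU_odd hn, leadingCoeff, natDegree_chebyshevU_odd hn]
  have : (((2 * (n - 1) : ℕ) : ℝ) + 1) = 2 * n - 1 := by
    rw [← Nat.cast_add_one, h, Nat.cast_sub (by lia)]
    push_cast
    ring
  rw [this]
  ring

theorem leadingCoeff_derivUSqrtReal {n : ℕ} (hn : 2 ≤ n) :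
    (derivUSqrtReal n).leadingCoeff = (2 * n - 1) * 2 ^ (2 * n - 1) := by
  rw [← leadingCoeff_derivU hn, ← expand_derivUSqrtReal, leadingCoeff_expand (by norm_num)]

theorem leadingCoeff_derivU_pos {n : ℕ} (hn : 2 ≤ n) :
    (0 : ℝ) < (2 * n - 1) * 2 ^ (2 * n - 1) := by
  have : (2 : ℝ) ≤ n := by exact_mod_cast hn
  have : (0 : ℝ) < 2 * n - 1 := by linarith
  positivity

theorem derivU_ne_zero {n : ℕ} (hn : 2 ≤ n) : derivU ℝ n ≠ 0 := by
  rw [← leadingCoeff_ne_zero, leadingCoeff_derivU hn]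
  exact (leadingCoeff_derivU_pos hn).ne'

theorem derivUSqrtReal_ne_zero {n : ℕ} (hn : 2 ≤ n) : derivUSqrtReal n ≠ 0 := by
  rw [← leadingCoeff_ne_zero, leadingCoeff_derivUSqrtReal hn]
  exact (leadingCoeff_derivU_pos hn).ne'

theorem one_sub_sq_mul_eval_derivU (n : ℕ) (x : ℝ) :
    (1 - x ^ 2) * (derivU ℝ n).eval x =
      x * (Chebyshev.U ℝ (2 * (n : ℤ) - 1)).eval x
        - 2 * n * (Chebyshev.T ℝ (2 * (n : ℤ))).eval x := by
  have h := congrArg (eval x) (Chebyshev.add_one_mul_T_eq_poly_in_U (R := ℝ) (2 * (n : ℤ) - 1))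
  rw [sub_add_cancel] at h
  simp only [eval_mul, eval_sub, eval_add, eval_pow, eval_one, eval_X, eval_intCast] at h
  push_cast at h
  rw [derivU]
  linear_combination h

theorem sq_eval_T_add_one_sub_sq_mul_sq_eval_U (k : ℕ) (x : ℝ) :
    ((Chebyshev.T ℝ k).eval x) ^ 2 + (1 - x ^ 2) * ((Chebyshev.U ℝ ((k : ℤ) - 1)).eval x) ^ 2 = 1 := by
  induction k with
  | zero => simp
  | succ k ih =>
    have h1 := congrArg (eval x) (Chebyshev.T_eq_X_mul_T_sub_pol_U ℝ ((k : ℤ) - 1))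
    have h2 := congrArg (eval x) (Chebyshev.U_eq_X_mul_U_add_T ℝ ((k : ℤ) - 1))
    rw [show (k : ℤ) - 1 + 2 = k + 1 by ring, sub_add_cancel] at h1
    rw [sub_add_cancel] at h2
    simp only [eval_mul, eval_sub, eval_add, eval_pow, eval_one, eval_X] at h1 h2
    push_cast
    rw [add_sub_cancel_right, h1, h2]
    linear_combination ih

theorem sq_eval_T_two_mul (n : ℕ) (x : ℝ) :
    ((Chebyshev.T ℝ (2 * (n : ℤ))).eval x) ^ 2 =
      1 - (1 - x ^ 2) * ((Chebyshev.U ℝ (2 * (n : ℤ) - 1)).eval x) ^ 2 := by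
  have h := sq_eval_T_add_one_sub_sq_mul_sq_eval_U (2 * n) x
  push_cast at h
  linear_combination h

theorem eval_zero_chebyshevU_odd (n : ℕ) : (Chebyshev.U ℝ (2 * (n : ℤ) - 1)).eval 0 = 0 := by
  have := eval_neg_chebyshevU_odd (n := n) 0
  rw [neg_zero] at this
  linarith

/-- Squaring discards the sign of `T_{2n}(0) = ±1`, which is never needed. -/
theorem sq_eval_derivU_zero (n : ℕ) : ((derivU ℝ n).eval 0) ^ 2 = (2 * n) ^ 2 := by
  have h1 := one_sub_sq_mul_eval_derivU n 0
  have h2 := sq_eval_T_two_mul n 0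
  rw [eval_zero_chebyshevU_odd] at h1 h2
  have : (derivU ℝ n).eval 0 = - (2 * n * (Chebyshev.T ℝ (2 * (n : ℤ))).eval 0) := by linarith
  rw [this, neg_sq, mul_pow, h2]
  ring

theorem eval_derivU_one (n : ℕ) :
    3 * (derivU ℝ n).eval 1 = 2 * n * ((2 * n - 1) * (2 * n + 1)) := by
  have h := Chebyshev.derivative_U_eval_one (R := ℝ) (2 * (n : ℤ) - 1)
  rw [derivU, h]
  push_cast
  ring

/-! ### Critical points and factorizations over the reals -/

theorem card_roots_chebyshevU_odd {n : ℕ} (hn : 2 ≤ n) :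
    (Chebyshev.U ℝ (2 * (n : ℤ) - 1)).roots.card = 2 * n - 1 := by
  rw [two_mul_sub_one_eq_natCast hn, Chebyshev.roots_U_real, Finset.card_val,
    Finset.card_image_of_injOn, Finset.card_range]
  exact (Finset.range _).nodup_map_iff_injOn.mp (Chebyshev.roots_U_real_nodup _)

theorem nodup_roots_chebyshevU_odd {n : ℕ} (hn : 2 ≤ n) :
    (Chebyshev.U ℝ (2 * (n : ℤ) - 1)).roots.Nodup := by
  rw [two_mul_sub_one_eq_natCast hn, Chebyshev.roots_U_real]
  exact Finset.nodup _

theorem mem_posRoots {n : ℕ} (hn : 2 ≤ n) {ζ : ℝ} :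
    ζ ∈ posRoots n ↔ (derivU ℝ n).eval ζ = 0 ∧ 0 < ζ := by
  rw [posRoots, Finset.mem_filter, Multiset.mem_toFinset, mem_roots (derivU_ne_zero hn), IsRoot.def]

/-- Rolle gives at least `2n-2` zeros of `U'`; they are symmetric about `0`, and `0` is not one of
them because `U'(0) = ±2n`. -/
theorem card_posRoots_ge {n : ℕ} (hn : 2 ≤ n) : n - 1 ≤ (posRoots n).card := by
  have h := card_roots_toFinset_le_derivative (Chebyshev.U ℝ (2 * (n : ℤ) - 1))
  rw [Multiset.toFinset_card_of_nodup (nodup_roots_chebyshevU_odd hn),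
    card_roots_chebyshevU_odd hn] at h
  change _ ≤ (derivU ℝ n).roots.toFinset.card + 1 at h
  have hsub : (derivU ℝ n).roots.toFinset ⊆ posRoots n ∪ (posRoots n).image (fun ζ => -ζ) := by
    intro ζ hζ
    rw [Multiset.mem_toFinset, mem_roots (derivU_ne_zero hn), IsRoot.def] at hζ
    rw [Finset.mem_union, Finset.mem_image, mem_posRoots hn]
    rcases lt_trichotomy ζ 0 with h0 | h0 | h0
    · exact Or.inr ⟨-ζ, (mem_posRoots hn).2 ⟨by rw [eval_neg_derivU, hζ], by linarith⟩, neg_neg ζ⟩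
    · have := sq_eval_derivU_zero n
      rw [← h0, hζ] at this
      have h3 : (n : ℝ) = 0 := by nlinarith
      norm_cast at h3
      lia
    · exact Or.inl ⟨hζ, h0⟩
  have h1 := Finset.card_le_card hsub
  have h2 := Finset.card_union_le (posRoots n) ((posRoots n).image (fun ζ => -ζ))
  have h3 := Finset.card_image_le (s := posRoots n) (f := fun ζ => -ζ)
  lia

theorem injOn_sq_posRoots {n : ℕ} (hn : 2 ≤ n) :
    Set.InjOn (fun ζ : ℝ => ζ ^ 2) (posRoots n : Set ℝ) := by
  intro x hx y hy hxy
  have hx' := ((mem_posRoots hn).1 hx).2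
  have hy' := ((mem_posRoots hn).1 hy).2
  exact (pow_left_inj₀ hx'.le hy'.le two_ne_zero).1 hxy

theorem card_posRoots_and_roots_derivUSqrtReal {n : ℕ} (hn : 2 ≤ n) :
    (posRoots n).card = n - 1 ∧
      (derivUSqrtReal n).roots = ((posRoots n).image (fun ζ => ζ ^ 2)).val := by
  have hsub : ((posRoots n).image (fun ζ => ζ ^ 2)).val ≤ (derivUSqrtReal n).roots := by
    rw [Multiset.le_iff_subset (Finset.nodup _)]
    intro x hx
    rw [Finset.mem_val, Finset.mem_image] at hx
    obtain ⟨ζ, hζ, rfl⟩ := hx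
    rw [mem_roots (derivUSqrtReal_ne_zero hn), IsRoot.def, eval_derivUSqrtReal_sq]
    exact ((mem_posRoots hn).1 hζ).1
  have hcard : ((posRoots n).image (fun ζ => ζ ^ 2)).val.card = (posRoots n).card :=
    Finset.card_image_of_injOn (injOn_sq_posRoots hn)
  have h1 := Multiset.card_le_card hsub
  have h2 := card_roots' (derivUSqrtReal n)
  rw [natDegree_derivUSqrtReal hn] at h2
  have h3 := card_posRoots_ge hn
  exact ⟨by lia, (Multiset.eq_of_le_of_card_le hsub (by lia)).symm⟩

theorem card_posRoots {n : ℕ} (hn : 2 ≤ n) : (posRoots n).card = n - 1 :=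
  (card_posRoots_and_roots_derivUSqrtReal hn).1

theorem derivUSqrtReal_eq_prod {n : ℕ} (hn : 2 ≤ n) :
    derivUSqrtReal n = C ((2 * (n : ℝ) - 1) * 2 ^ (2 * n - 1)) *
      ∏ ζ ∈ posRoots n, (X - C (ζ ^ 2)) := by
  have h : (derivUSqrtReal n).roots.card = (derivUSqrtReal n).natDegree := by
    rw [(card_posRoots_and_roots_derivUSqrtReal hn).2, natDegree_derivUSqrtReal hn,
      Finset.card_val, Finset.card_image_of_injOn (injOn_sq_posRoots hn), card_posRoots hn]
  conv_lhs => rw [← C_leadingCoeff_mul_prod_multiset_X_sub_C h]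
  rw [leadingCoeff_derivUSqrtReal hn, (card_posRoots_and_roots_derivUSqrtReal hn).2,
    Finset.prod_map_val, Finset.prod_image (injOn_sq_posRoots hn)]

theorem eval_derivU_eq_prod {n : ℕ} (hn : 2 ≤ n) (y : ℝ) :
    (derivU ℝ n).eval y = (2 * (n : ℝ) - 1) * 2 ^ (2 * n - 1) *
      ∏ ζ ∈ posRoots n, (y ^ 2 - ζ ^ 2) := by
  rw [← eval_derivUSqrtReal_sq, derivUSqrtReal_eq_prod hn, eval_mul, eval_C, eval_prod]
  simp

/-- The real roots of `U_{2n-1}`. -/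
def chebyshevRoots (n : ℕ) : Finset ℝ := (Chebyshev.U ℝ (2 * (n : ℤ) - 1)).roots.toFinset

theorem card_chebyshevRoots {n : ℕ} (hn : 2 ≤ n) : (chebyshevRoots n).card = 2 * n - 1 := by
  rw [chebyshevRoots, Multiset.toFinset_card_of_nodup (nodup_roots_chebyshevU_odd hn),
    card_roots_chebyshevU_odd hn]

theorem eval_chebyshevU_eq_prod {n : ℕ} (hn : 2 ≤ n) (y : ℝ) :
    (Chebyshev.U ℝ (2 * (n : ℤ) - 1)).eval y = 2 ^ (2 * n - 1) *
      ∏ η ∈ chebyshevRoots n, (y - η) := by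
  have h := C_leadingCoeff_mul_prod_multiset_X_sub_C (p := Chebyshev.U ℝ (2 * (n : ℤ) - 1))
    (by rw [card_roots_chebyshevU_odd hn, natDegree_chebyshevU_odd hn])
  conv_lhs => rw [← h]
  rw [leadingCoeff_chebyshevU_odd hn, eval_mul, eval_C, chebyshevRoots, eval_multiset_prod,
    Finset.prod, Multiset.toFinset_val, (nodup_roots_chebyshevU_odd hn).dedup, Multiset.map_map]
  simp

/-! ### Resultant of `U` and `U'` -/

theorem eval_eq_zero_of_mem_chebyshevRoots {n : ℕ} {η : ℝ} (h : η ∈ chebyshevRoots n) :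
    (Chebyshev.U ℝ (2 * (n : ℤ) - 1)).eval η = 0 := by
  rw [chebyshevRoots, Multiset.mem_toFinset] at h
  exact (mem_roots'.1 h).2

/-- The Pell identity `T² + (1-x²)U² = 1` forces `T_{2n}(η) = ±1` where `U` vanishes. -/
theorem abs_one_sub_sq_mul_eval_derivU {n : ℕ} {η : ℝ} (h : η ∈ chebyshevRoots n) :
    |1 - η ^ 2| * |(derivU ℝ n).eval η| = 2 * n := by
  have h1 := one_sub_sq_mul_eval_derivU n η
  have h2 := sq_eval_T_two_mul n η
  rw [eval_eq_zero_of_mem_chebyshevRoots h] at h1 h2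
  have h3 : |(Chebyshev.T ℝ (2 * (n : ℤ))).eval η| = 1 := by
    rw [← sq_eq_sq₀ (abs_nonneg _) zero_le_one, sq_abs, h2]
    ring
  rw [← abs_mul, h1, mul_zero, zero_sub, abs_neg, abs_mul, h3, mul_one, abs_of_nonneg (by positivity)]

/-- Factor `U(1)U(-1) = -(2n)²` over the zeros of `U`. -/
theorem abs_prod_one_sub_sq {n : ℕ} (hn : 2 ≤ n) :
    4 ^ (2 * n - 1) * ∏ η ∈ chebyshevRoots n, |1 - η ^ 2| = (2 * (n : ℝ)) ^ 2 := by
  have h1 := eval_chebyshevU_eq_prod hn 1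
  have h2 := eval_chebyshevU_eq_prod hn (-1)
  have h0 : (Chebyshev.U ℝ (2 * (n : ℤ) - 1)).eval 1 = 2 * n := by
    rw [Chebyshev.U_eval_one]
    push_cast
    ring
  rw [eval_neg_chebyshevU_odd] at h2
  rw [h0] at h1 h2
  have h4 : (4 : ℝ) ^ (2 * n - 1) = |(2 : ℝ) ^ (2 * n - 1) * 2 ^ (2 * n - 1)| := by
    rw [← mul_pow, abs_of_nonneg (by positivity)]
    norm_num
  have h5 : (2 * (n : ℝ)) ^ 2 = |2 * (n : ℝ) * -(2 * n)| := by
    rw [mul_neg, abs_neg, abs_of_nonneg (by positivity)]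
    ring
  rw [← Finset.abs_prod, h4, h5, ← abs_mul]
  conv_rhs => rw [h2]; rw [h1]
  have h6 : ∏ η ∈ chebyshevRoots n, (1 - η ^ 2) = (-1) ^ (2 * n - 1) *
      ((∏ η ∈ chebyshevRoots n, (1 - η)) * ∏ η ∈ chebyshevRoots n, (-1 - η)) := by
    rw [← Finset.prod_mul_distrib, ← card_chebyshevRoots hn, ← Finset.prod_const,
      ← Finset.prod_mul_distrib]
    exact Finset.prod_congr rfl fun η _ => by ring
  rw [h6, mul_left_comm, abs_mul, abs_pow, abs_neg, abs_one, one_pow, one_mul]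
  congr 1
  ring

theorem abs_prod_eval_derivU {n : ℕ} (hn : 2 ≤ n) :
    (∏ η ∈ chebyshevRoots n, |(derivU ℝ n).eval η|) =
      4 ^ (2 * n - 1) * (2 * (n : ℝ)) ^ (2 * n - 3) := by
  have h1 := abs_prod_one_sub_sq hn
  have h2 : (∏ η ∈ chebyshevRoots n, |1 - η ^ 2|) * ∏ η ∈ chebyshevRoots n, |(derivU ℝ n).eval η|
      = (2 * (n : ℝ)) ^ (2 * n - 1) := by
    rw [← Finset.prod_mul_distrib, Finset.prod_congr rfl
      (fun η h => abs_one_sub_sq_mul_eval_derivU h), Finset.prod_const, card_chebyshevRoots hn]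
  have hn0 : (0 : ℝ) < 2 * n := by
    have : 0 < n := by lia
    positivity
  have h3 : (2 * (n : ℝ)) ^ (2 * n - 1) = (2 * (n : ℝ)) ^ 2 * (2 * (n : ℝ)) ^ (2 * n - 3) := by
    rw [← pow_add]
    congr 1
    lia
  rw [h3] at h2
  have h4 : (2 * (n : ℝ)) ^ 2 ≠ 0 := by positivity
  apply mul_left_cancel₀ h4
  linear_combination (-∏ η ∈ chebyshevRoots n, |(derivU ℝ n).eval η|) * h1 + 4 ^ (2 * n - 1) * h2

theorem prod_sub_sq_chebyshevRoots {n : ℕ} (hn : 2 ≤ n) (ζ : ℝ) :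
    4 ^ (2 * n - 1) * ∏ η ∈ chebyshevRoots n, |η ^ 2 - ζ ^ 2| =
      ((Chebyshev.U ℝ (2 * (n : ℤ) - 1)).eval ζ) ^ 2 := by
  have h1 := eval_chebyshevU_eq_prod hn ζ
  have h2 := eval_chebyshevU_eq_prod hn (-ζ)
  rw [eval_neg_chebyshevU_odd, neg_eq_iff_eq_neg] at h2
  have h4 : (4 : ℝ) ^ (2 * n - 1) = |(2 : ℝ) ^ (2 * n - 1) * 2 ^ (2 * n - 1)| := by
    rw [← mul_pow, abs_of_nonneg (by positivity)]
    norm_num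
  rw [← abs_of_nonneg (sq_nonneg (eval ζ _)), sq (eval ζ _)]
  conv_rhs => enter [1, 1]; rw [h2]
  rw [h1, ← Finset.abs_prod, h4, ← abs_mul, neg_mul, abs_neg]
  have h6 : ∏ η ∈ chebyshevRoots n, (η ^ 2 - ζ ^ 2) =
      (∏ η ∈ chebyshevRoots n, (ζ - η)) * ∏ η ∈ chebyshevRoots n, (-ζ - η) := by
    rw [← Finset.prod_mul_distrib]
    exact Finset.prod_congr rfl fun η _ => by ring
  rw [h6]
  congr 1
  ring

/-- The product of the squares of the critical values of `U_{2n-1}` at positive critical points. -/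
theorem prod_eval_chebyshevU_sq {n : ℕ} (hn : 2 ≤ n) :
    (2 * (n : ℝ) - 1) ^ (2 * n - 1) *
        (∏ ζ ∈ posRoots n, (Chebyshev.U ℝ (2 * (n : ℤ) - 1)).eval ζ) ^ 2 =
      (2 * (n : ℝ)) ^ (2 * n - 3) * 2 ^ (2 * n - 1) := by
  have h1 := abs_prod_eval_derivU hn
  have ha := leadingCoeff_derivU_pos hn
  simp_rw [eval_derivU_eq_prod hn, abs_mul _ (∏ _ ∈ _, _), Finset.abs_prod] at h1
  rw [Finset.prod_mul_distrib, Finset.prod_const, card_chebyshevRoots hn, abs_of_pos ha,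
    Finset.prod_comm] at h1
  -- After the swap in `h1`, the inner product over the zeros `η` is `U(ζ)²` up to a power of `4`.
  have h2 : (4 ^ (2 * n - 1)) ^ (n - 1) *
      ∏ ζ ∈ posRoots n, ∏ η ∈ chebyshevRoots n, |η ^ 2 - ζ ^ 2| =
      (∏ ζ ∈ posRoots n, (Chebyshev.U ℝ (2 * (n : ℤ) - 1)).eval ζ) ^ 2 := by
    rw [← card_posRoots hn, ← Finset.prod_const, ← Finset.prod_mul_distrib, ← Finset.prod_pow]
    exact Finset.prod_congr rfl fun ζ _ => prod_sub_sq_chebyshevRoots hn ζ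
  rw [← h2]
  have h3 : ((2 : ℝ) ^ (2 * n - 1)) ^ (2 * n - 1) ≠ 0 := by positivity
  apply mul_left_cancel₀ h3
  rw [mul_pow] at h1
  have h4 : ((2 : ℝ) ^ (2 * n - 1)) ^ (2 * n - 1) * 2 ^ (2 * n - 1) =
      (4 ^ (2 * n - 1)) ^ (n - 1) * 4 ^ (2 * n - 1) := by
    obtain ⟨k, rfl⟩ := Nat.exists_eq_add_of_le hn
    rw [show (4 : ℝ) = 2 ^ 2 by norm_num, show 2 * (2 + k) - 1 = 2 * k + 3 by lia,
      show 2 + k - 1 = k + 1 by lia]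
    simp only [← pow_mul, ← pow_add]
    congr 1
    ring
  linear_combination (4 ^ (2 * n - 1)) ^ (n - 1) * h1 - (2 * (n : ℝ)) ^ (2 * n - 3) * h4

/-! ### General facts on discriminants -/

section discr

variable {K : Type*} [Field K]

theorem discr_map_of_injective {R S : Type*} [CommRing R] [IsDomain R] [CommRing S] [IsDomain S]
    {φ : R →+* S} (hφ : Function.Injective φ) {f : R[X]} (hf : 0 < f.natDegree) :
    (f.map φ).discr = φ f.discr := by
  have h1 := resultant_deriv (natDegree_pos_iff_degree_pos.1 hf)
  have h2 := resultant_deriv (f := f.map φ) (by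
    rw [← natDegree_pos_iff_degree_pos, natDegree_map_eq_of_injective hφ]; exact hf)
  rw [derivative_map, natDegree_map_eq_of_injective hφ, resultant_map_map, h1,
    leadingCoeff_map_of_injective hφ] at h2
  simp only [map_mul, map_pow, map_neg, map_one] at h2
  refine (mul_left_cancel₀ (mul_ne_zero (pow_ne_zero _ (neg_ne_zero.2 one_ne_zero)) ?_) h2).symm
  rw [map_ne_zero_iff φ hφ, leadingCoeff_ne_zero]
  rintro rfl
  simp at hf

theorem discr_C_mul {f : K[X]} (hf : 0 < f.natDegree) {c : K} (hc : c ≠ 0) :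
    (C c * f).discr = c ^ (2 * (f.natDegree - 1)) * f.discr := by
  have h1 := resultant_deriv (natDegree_pos_iff_degree_pos.1 hf)
  have hd : (C c * f).natDegree = f.natDegree := natDegree_C_mul hc
  have h2 := resultant_deriv (f := C c * f) (by
    rw [← natDegree_pos_iff_degree_pos, hd]; exact hf)
  rw [hd, derivative_C_mul, resultant_C_mul_left, resultant_C_mul_right, h1, leadingCoeff_mul,
    leadingCoeff_C] at h2
  have h3 : f.leadingCoeff ≠ 0 := by
    rw [leadingCoeff_ne_zero]
    rintro rfl
    simp at hf
  have h4 : c ^ f.natDegree = c ^ (f.natDegree - 1) * c := by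
    rw [← pow_succ]
    congr 1
    lia
  have h5 : (-1 : K) ^ (f.natDegree * (f.natDegree - 1) / 2) ≠ 0 :=
    pow_ne_zero _ (neg_ne_zero.2 one_ne_zero)
  apply mul_left_cancel₀ (mul_ne_zero (mul_ne_zero h5 h3) hc)
  rw [h4] at h2
  rw [two_mul, pow_add]
  linear_combination -h2

theorem discr_taylor [CharZero K] {f : K[X]} (hf : 0 < f.natDegree) (r : K) : (taylor r f).discr = f.discr := by
  have h1 := resultant_deriv (natDegree_pos_iff_degree_pos.1 hf)
  have hd : (taylor r f).natDegree = f.natDegree := natDegree_taylor f r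
  have h2 := resultant_deriv (f := taylor r f) (by
    rw [← natDegree_pos_iff_degree_pos, hd]; exact hf)
  have h6 : derivative (taylor r f) = taylor r (derivative f) := by
    rw [taylor_apply, taylor_apply, derivative_comp]
    simp
  have h7 := resultant_taylor f (derivative f) r
  rw [natDegree_taylor, natDegree_taylor, natDegree_derivative] at h7
  rw [hd, h6, h7, h1, leadingCoeff_taylor] at h2
  refine (mul_left_cancel₀ (mul_ne_zero (pow_ne_zero _ (neg_ne_zero.2 one_ne_zero)) ?_) h2).symm
  rw [leadingCoeff_ne_zero]
  rintro rfl
  simp at hf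

theorem discr_eq_prod_eval_derivative {f : K[X]} (hf : 0 < f.natDegree) (hs : f.Splits) :
    (-1) ^ (f.natDegree * (f.natDegree - 1) / 2) * f.leadingCoeff * f.discr =
      f.leadingCoeff ^ (f.natDegree - 1) * (f.roots.map (derivative f).eval).prod := by
  rw [← resultant_deriv (natDegree_pos_iff_degree_pos.1 hf),
    resultant_eq_prod_eval _ _ _ (natDegree_derivative_le f) hs]

/-- Each unordered pair contributes `-(x-y)²`, and there are `card * (card - 1) / 2` pairs. -/
theorem prod_prod_sub_sign_pos (s : Finset ℝ) :
    0 < (-1 : ℝ) ^ (s.card * (s.card - 1) / 2) * ∏ x ∈ s, ∏ y ∈ s.erase x, (x - y) := by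
  induction s using Finset.induction_on with
  | empty => simp
  | insert a s ha ih =>
    have h1 : ∏ x ∈ insert a s, ∏ y ∈ (insert a s).erase x, (x - y) =
        (-1) ^ s.card * (∏ y ∈ s, (a - y)) ^ 2 * ∏ x ∈ s, ∏ y ∈ s.erase x, (x - y) := by
      have h4 : ∏ x ∈ s, ∏ y ∈ (insert a s).erase x, (x - y) =
          (∏ x ∈ s, (x - a)) * ∏ x ∈ s, ∏ y ∈ s.erase x, (x - y) := by
        rw [← Finset.prod_mul_distrib]
        refine Finset.prod_congr rfl fun x hx => ?_
        have hxa : a ≠ x := by rintro rfl; exact ha hx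
        rw [Finset.erase_insert_of_ne hxa,
          Finset.prod_insert fun h => ha (Finset.mem_of_mem_erase h)]
      have h5 : ∏ x ∈ s, (x - a) = (-1) ^ s.card * ∏ x ∈ s, (a - x) := by
        rw [← Finset.prod_const, ← Finset.prod_mul_distrib]
        exact Finset.prod_congr rfl fun x _ => by ring
      rw [Finset.prod_insert ha, Finset.erase_insert ha, h4, h5]
      ring
    have h2 : (-1 : ℝ) ^ ((insert a s).card * ((insert a s).card - 1) / 2) * (-1) ^ s.card =
        (-1) ^ (s.card * (s.card - 1) / 2) := by
      rw [Finset.card_insert_of_notMem ha, Nat.add_sub_cancel]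
      have h3 : (s.card + 1) * s.card / 2 = s.card * (s.card - 1) / 2 + s.card := by
        rcases Nat.eq_zero_or_pos s.card with h | h
        · simp [h]
        · obtain ⟨k, hk⟩ := Nat.exists_eq_add_of_lt h
          rw [hk, show 0 + k + 1 - 1 = k by lia,
            show (0 + k + 1 + 1) * (0 + k + 1) = (0 + k + 1) * k + 2 * (0 + k + 1) by ring,
            Nat.add_mul_div_left _ _ two_pos]
      rw [h3, pow_add, mul_assoc, ← mul_pow]
      simp
    rw [h1, ← mul_assoc, ← mul_assoc, h2, mul_right_comm]
    refine mul_pos ih (sq_pos_of_ne_zero ?_)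
    rw [Finset.prod_ne_zero_iff]
    intro y hy
    rw [sub_ne_zero]
    rintro rfl
    exact ha hy

theorem discr_pos_of_eq_prod {c : ℝ} (hc : 0 < c) {s : Finset ℝ} (hs : s.Nonempty) :
    0 < (C c * ∏ x ∈ s, (X - C x)).discr := by
  have hdeg : (∏ x ∈ s, (X - C x)).natDegree = s.card := natDegree_finsetProd_X_sub_C_eq_card s id
  have hpos : 0 < (∏ x ∈ s, (X - C x)).natDegree := by rw [hdeg]; exact hs.card_pos
  have hm : (∏ x ∈ s, (X - C x)).Monic := monic_prod_of_monic _ _ fun x _ => monic_X_sub_C x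
  rw [discr_C_mul hpos hc.ne']
  refine mul_pos (pow_pos hc _) ?_
  have h := discr_eq_prod_eval_derivative hpos
    (Splits.prod fun x _ => Splits.X_sub_C x)
  rw [hm.leadingCoeff, hdeg, one_pow, one_mul, mul_one, roots_prod_X_sub_C,
    Finset.prod_map_val] at h
  have h2 : ∏ x ∈ s, (derivative (∏ x ∈ s, (X - C x))).eval x = ∏ x ∈ s, ∏ y ∈ s.erase x, (x - y) :=
    Finset.prod_congr rfl fun x hx => by
      have := Lagrange.eval_nodal_derivative_eval_node_eq (s := s) (v := id) hx
      simpa [Lagrange.nodal, eval_prod] using this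
  have h3 := prod_prod_sub_sign_pos s
  rw [← h2, ← h, ← mul_assoc, ← mul_pow] at h3
  simpa using h3

/-- All coefficients of `f'` vanish mod `p`, hence so does the first column of the `f'` block in the
Sylvester matrix defining `discr`. The modified last row of `sylvesterDeriv` has a zero in that
column only when the degree is at least `2`; linear polynomials have discriminant `1`. -/
theorem dvd_discr_of_forall_dvd_coeff {p : ℕ} {f : ℤ[X]} (hf : 2 ≤ f.natDegree)
    (h : ∀ k, 1 ≤ k → (p : ℤ) ∣ f.coeff k) : (p : ℤ) ∣ f.discr := by
  rw [discr]
  apply Dvd.dvd.mul_right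
  rw [← ZMod.intCast_zmod_eq_zero_iff_dvd, ← eq_intCast (Int.castRingHom (ZMod p)), RingHom.map_det]
  apply Matrix.det_eq_zero_of_column_eq_zero ⟨f.natDegree - 1, by lia⟩
  intro i
  rw [RingHom.mapMatrix_apply, Matrix.map_apply, sylvesterDeriv, dif_neg (by lia),
    Matrix.updateRow_apply]
  split_ifs with h1 h2 h3
  · simp at h2; lia
  · simp at h3; lia
  · simp
  · have h4 : (⟨f.natDegree - 1, by lia⟩ : Fin (f.natDegree - 1 + f.natDegree)) =
        Fin.natAdd (f.natDegree - 1) ⟨0, by lia⟩ := by ext; simp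
    rw [sylvester, Matrix.of_apply, h4, Fin.addCases_right]
    split_ifs
    · rw [coeff_derivative, eq_intCast, ZMod.intCast_zmod_eq_zero_iff_dvd]
      exact Dvd.dvd.mul_right (h _ (by lia)) _
    · simp

end discr

/-! ### The discriminant of `U'(√x)` -/

theorem one_sub_sq_mul_eval_derivative_derivU (n : ℕ) (x : ℝ) :
    (1 - x ^ 2) * (derivative (derivU ℝ n)).eval x = 3 * x * (derivU ℝ n).eval x -
      (2 * n - 1) * (2 * n + 1) * (Chebyshev.U ℝ (2 * (n : ℤ) - 1)).eval x := by
  have h := congrArg (eval x)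
    (Chebyshev.one_sub_X_sq_mul_derivative_derivative_U_eq_poly_in_U (R := ℝ) (2 * (n : ℤ) - 1))
  simp only [eval_mul, eval_sub, eval_add, eval_pow, eval_one, eval_X, eval_intCast,
    Function.iterate_succ, Function.iterate_zero, Function.comp_apply, id, eval_ofNat] at h
  push_cast at h
  rw [derivU]
  linear_combination h

theorem eval_derivative_derivU (n : ℕ) (x : ℝ) :
    (derivative (derivU ℝ n)).eval x = 2 * x * (derivative (derivUSqrtReal n)).eval (x ^ 2) := by
  rw [← expand_derivUSqrtReal, derivative_expand, eval_mul, expand_eval]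
  simp
  ring

theorem eval_derivative_derivUSqrtReal {n : ℕ} (hn : 2 ≤ n) {ζ : ℝ} (hζ : ζ ∈ posRoots n) :
    2 * ζ * (1 - ζ ^ 2) * (derivative (derivUSqrtReal n)).eval (ζ ^ 2) =
      -((2 * n - 1) * (2 * n + 1)) * (Chebyshev.U ℝ (2 * (n : ℤ) - 1)).eval ζ := by
  have h1 := one_sub_sq_mul_eval_derivative_derivU n ζ
  rw [eval_derivative_derivU, ((mem_posRoots hn).1 hζ).1] at h1
  linear_combination h1

theorem prod_posRoots_sq {n : ℕ} (hn : 2 ≤ n) :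
    (2 * (n : ℝ) - 1) * 2 ^ (2 * n - 1) * ∏ ζ ∈ posRoots n, ζ ^ 2 = 2 * n := by
  have h := sq_eval_derivU_zero n
  rw [eval_derivU_eq_prod hn, ← sq_abs, sq_eq_sq₀ (abs_nonneg _) (by positivity), abs_mul,
    abs_of_pos (leadingCoeff_derivU_pos hn), Finset.abs_prod] at h
  refine Eq.trans (congrArg (_ * ·) (Finset.prod_congr rfl fun ζ _ => ?_)) h
  rw [zero_pow two_ne_zero, zero_sub, abs_neg, abs_of_nonneg (sq_nonneg _)]

theorem prod_one_sub_posRoots_sq {n : ℕ} (hn : 2 ≤ n) :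
    3 * ((2 * (n : ℝ) - 1) * 2 ^ (2 * n - 1) * ∏ ζ ∈ posRoots n, (1 - ζ ^ 2)) =
      2 * n * ((2 * n - 1) * (2 * n + 1)) := by
  rw [← eval_derivU_one, eval_derivU_eq_prod hn, one_pow]

theorem discr_derivUSqrtReal_pos {n : ℕ} (hn : 2 ≤ n) : 0 < (derivUSqrtReal n).discr := by
  have h : ∏ ζ ∈ posRoots n, (X - C (ζ ^ 2)) = ∏ x ∈ (posRoots n).image (fun ζ => ζ ^ 2), (X - C x) :=
    (Finset.prod_image (f := fun x : ℝ => X - C x) (injOn_sq_posRoots hn)).symm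
  rw [derivUSqrtReal_eq_prod hn, h]
  refine discr_pos_of_eq_prod (leadingCoeff_derivU_pos hn) (Finset.Nonempty.image ?_ _)
  rw [← Finset.card_pos, card_posRoots hn]
  lia

theorem sq_discr_derivUSqrtReal {n : ℕ} (hn : 2 ≤ n) :
    ((2 * (n : ℝ) - 1) * 2 ^ (2 * n - 1)) ^ 2 * (derivUSqrtReal n).discr ^ 2 =
      ((2 * (n : ℝ) - 1) * 2 ^ (2 * n - 1)) ^ (2 * (n - 2)) *
        (∏ ζ ∈ posRoots n, (derivative (derivUSqrtReal n)).eval (ζ ^ 2)) ^ 2 := by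
  have hpos : 0 < (derivUSqrtReal n).natDegree := by rw [natDegree_derivUSqrtReal hn]; lia
  have hs : (derivUSqrtReal n).Splits := by
    rw [derivUSqrtReal_eq_prod hn]
    exact (Splits.C _).mul (Splits.prod fun x _ => Splits.X_sub_C _)
  have h := congrArg (· ^ 2) (discr_eq_prod_eval_derivative hpos hs)
  rw [natDegree_derivUSqrtReal hn, leadingCoeff_derivUSqrtReal hn,
    (card_posRoots_and_roots_derivUSqrtReal hn).2, Finset.prod_map_val,
    Finset.prod_image (injOn_sq_posRoots hn)] at h
  generalize (2 * (n : ℝ) - 1) * 2 ^ (2 * n - 1) = a at h ⊢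
  simp only [mul_pow, ← pow_mul] at h ⊢
  rw [mul_comm _ 2, pow_mul _ 2 (_ / 2), neg_one_sq, one_pow, one_mul,
    show (n - 1 - 1) * 2 = 2 * (n - 2) by lia] at h
  exact h

/-- Pure elimination. In the application `k = n-2`, `ν = n`, `b = 2n-1`, `c = 2n+1`, `D = Disc P`,
`E = ∏ P'(ζ²)`, `Z = ∏ ζ²`, `W = ∏ (1-ζ²)`, `Q = (∏ U(ζ))²`. The factor `bν` on the left avoids the
exponent `n-3`, negative for `n = 2`. -/
theorem discr_eq_of_product_relations {k : ℕ} {ν b c D E Z W Q : ℝ} (hν : 0 < ν) (hb : 0 < b)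
    (hc : 0 < c) (h1 : (b * 2 ^ (2 * k + 3)) ^ 2 * D ^ 2 = (b * 2 ^ (2 * k + 3)) ^ (2 * k) * E ^ 2)
    (h2 : b * 2 ^ (2 * k + 3) * Z = 2 * ν) (h3 : 3 * (b * 2 ^ (2 * k + 3) * W) = 2 * ν * (b * c))
    (h4 : b ^ (2 * k + 3) * Q = (2 * ν) ^ (2 * k + 1) * 2 ^ (2 * k + 3))
    (h5 : 4 ^ (k + 1) * Z * W ^ 2 * E ^ 2 = ((b * c) ^ (k + 1)) ^ 2 * Q) :
    (D * (b * ν)) ^ 2 = (3 * (c * b * ν) ^ k * 2 ^ (2 * k ^ 2 + 5 * k + 1)) ^ 2 := by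
  have h6 : 8 * 4 ^ (k + 1) * ν ^ 3 * E ^ 2 =
      9 * (b * 2 ^ (2 * k + 3)) ^ 3 * (b * c) ^ (2 * k) * Q := by
    have hbc : (b * c) ^ 2 ≠ 0 := by positivity
    apply mul_left_cancel₀ hbc
    generalize b * 2 ^ (2 * k + 3) = a at *
    calc (b * c) ^ 2 * (8 * 4 ^ (k + 1) * ν ^ 3 * E ^ 2)
        = 4 ^ (k + 1) * (2 * ν) * (2 * ν * (b * c)) ^ 2 * E ^ 2 := by ring
      _ = 9 * a ^ 3 * (4 ^ (k + 1) * Z * W ^ 2 * E ^ 2) := by rw [← h3, ← h2]; ring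
      _ = (b * c) ^ 2 * (9 * a ^ 3 * (b * c) ^ (2 * k) * Q) := by rw [h5]; ring
  have h7 : 8 * 4 ^ (k + 1) * ν ^ 3 * b ^ (2 * k + 3) * ((b * 2 ^ (2 * k + 3)) ^ 2 * D ^ 2) =
      9 * (b * 2 ^ (2 * k + 3)) ^ (2 * k + 3) * (b * c) ^ (2 * k) *
        ((2 * ν) ^ (2 * k + 1) * 2 ^ (2 * k + 3)) := by
    rw [h1, ← h4]
    linear_combination b ^ (2 * k + 3) * (b * 2 ^ (2 * k + 3)) ^ (2 * k) * h6
  have h8 : ν * b ^ (2 * k + 3) * (2 : ℝ) ^ (6 * k + 11) ≠ 0 := by positivity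
  apply mul_left_cancel₀ h8
  have h9 : ν * b ^ (2 * k + 3) * (2 : ℝ) ^ (6 * k + 11) * (D * (b * ν)) ^ 2 =
      8 * 4 ^ (k + 1) * ν ^ 3 * b ^ (2 * k + 3) * ((b * 2 ^ (2 * k + 3)) ^ 2 * D ^ 2) := by
    have h10 : (2 : ℝ) ^ (6 * k + 11) = 8 * 4 ^ (k + 1) * (2 ^ (2 * k + 3)) ^ 2 := by
      rw [show (8 : ℝ) = 2 ^ 3 by norm_num, show (4 : ℝ) = 2 ^ 2 by norm_num]
      simp only [← pow_mul, ← pow_add]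
      congr 1
      ring
    rw [h10]
    ring
  rw [h9, h7]
  have h11 : ((2 : ℝ) ^ (2 * k + 3)) ^ (2 * k + 3) * 2 ^ (2 * k + 1) * 2 ^ (2 * k + 3) =
      2 ^ (6 * k + 11) * (2 ^ (2 * k ^ 2 + 5 * k + 1)) ^ 2 := by
    simp only [← pow_mul, ← pow_add]
    congr 1
    ring
  simp only [mul_pow]
  linear_combination (9 * b ^ (2 * k + 3) * b ^ (2 * k) * c ^ (2 * k) * ν ^ (2 * k + 1)) * h11

theorem discr_derivUSqrtReal_mul {n : ℕ} (hn : 2 ≤ n) :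
    (derivUSqrtReal n).discr * ((2 * n - 1) * n) =
      3 * ((2 * (n : ℝ) + 1) * (2 * n - 1) * n) ^ (n - 2) * 2 ^ (2 * n ^ 2 - 3 * n - 1) := by
  have hn2 : (2 : ℝ) ≤ n := by exact_mod_cast hn
  have hb : (0 : ℝ) < 2 * n - 1 := by linarith
  have hdisc := discr_derivUSqrtReal_pos hn
  have h1 := sq_discr_derivUSqrtReal hn
  have h2 := prod_posRoots_sq hn
  have h3 := prod_one_sub_posRoots_sq hn
  have h4 := prod_eval_chebyshevU_sq hn
  have h5 : 4 ^ (n - 1) * (∏ ζ ∈ posRoots n, ζ ^ 2) * (∏ ζ ∈ posRoots n, (1 - ζ ^ 2)) ^ 2 *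
      (∏ ζ ∈ posRoots n, (derivative (derivUSqrtReal n)).eval (ζ ^ 2)) ^ 2 =
      (((2 * (n : ℝ) - 1) * (2 * n + 1)) ^ (n - 1)) ^ 2 *
        (∏ ζ ∈ posRoots n, (Chebyshev.U ℝ (2 * (n : ℤ) - 1)).eval ζ) ^ 2 := by
    rw [← card_posRoots hn, ← Finset.prod_const, ← Finset.prod_const]
    simp only [← Finset.prod_pow, ← Finset.prod_mul_distrib]
    refine Finset.prod_congr rfl fun ζ hζ => ?_
    have h := congrArg (· ^ 2) (eval_derivative_derivUSqrtReal hn hζ)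
    linear_combination h
  rw [← sq_eq_sq₀ (by positivity) (by positivity)]
  obtain ⟨k, hk⟩ := Nat.exists_eq_add_of_le hn
  rw [show 2 * n - 1 = 2 * k + 3 by lia, show n - 2 = k by lia] at *
  rw [show 2 * n - 3 = 2 * k + 1 by lia] at h4
  rw [show n - 1 = k + 1 by lia] at h5
  have h6 : 2 * n ^ 2 - 3 * n - 1 = 2 * k ^ 2 + 5 * k + 1 := by
    rw [hk, show 2 * (2 + k) ^ 2 = 2 * k ^ 2 + 5 * k + 1 + 1 + 3 * (2 + k) by ring,
      Nat.add_sub_cancel, Nat.add_sub_cancel]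
  rw [h6]
  exact discr_eq_of_product_relations (by linarith) hb (by linarith) h1 h2 h3 h4 h5

theorem natDegree_derivUSqrt {n : ℕ} (hn : 2 ≤ n) : (derivUSqrt n).natDegree = n - 1 := by
  rw [← natDegree_derivUSqrtReal hn, derivUSqrtReal,
    natDegree_map_eq_of_injective (RingHom.injective_int _)]

theorem discr_derivUSqrt_mul {n : ℕ} (hn : 2 ≤ n) :
    (derivUSqrt n).discr * ((2 * n - 1) * n) =
      3 * ((2 * (n : ℤ) + 1) * (2 * n - 1) * n) ^ (n - 2) * 2 ^ (2 * n ^ 2 - 3 * n - 1) := by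
  have h := discr_derivUSqrtReal_mul hn
  rw [derivUSqrtReal, discr_map_of_injective (RingHom.injective_int _)
    (by rw [natDegree_derivUSqrt hn]; lia), eq_intCast] at h
  exact_mod_cast h

theorem discr_derivUSqrt_eq {n : ℕ} (hn : 2 ≤ n) :
    ((derivUSqrt n).discr : ℚ) =
      3 * (2 * (n : ℚ) + 1) ^ ((n : ℤ) - 2) * (2 * (n : ℚ) - 1) ^ ((n : ℤ) - 3) *
        (n : ℚ) ^ ((n : ℤ) - 3) * (2 : ℚ) ^ (2 * (n : ℤ) ^ 2 - 3 * (n : ℤ) - 1) := by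
  have h : ((derivUSqrt n).discr : ℚ) * ((2 * n - 1) * n) =
      3 * ((2 * (n : ℚ) + 1) * (2 * n - 1) * n) ^ (n - 2) * 2 ^ (2 * n ^ 2 - 3 * n - 1) := by
    exact_mod_cast discr_derivUSqrt_mul hn
  have hn2 : (2 : ℚ) ≤ n := by exact_mod_cast hn
  have hb : (2 * (n : ℚ) - 1) ≠ 0 := by linarith
  have hn0 : (n : ℚ) ≠ 0 := by linarith
  obtain ⟨k, hk⟩ := Nat.exists_eq_add_of_le hn
  have h6 : 2 * (n : ℤ) ^ 2 - 3 * (n : ℤ) - 1 = ((2 * n ^ 2 - 3 * n - 1 : ℕ) : ℤ) := by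
    have : 3 * n + 1 ≤ 2 * n ^ 2 := by nlinarith
    push_cast [Nat.sub_sub, Nat.cast_sub this]
    ring
  rw [h6, show (n : ℤ) - 2 = ((n - 2 : ℕ) : ℤ) by lia,
    show (n : ℤ) - 3 = ((n - 2 : ℕ) : ℤ) - 1 by lia, zpow_sub_one₀ hb, zpow_sub_one₀ hn0]
  simp only [zpow_natCast]
  field_simp
  simp only [mul_pow] at h
  linear_combination h

/-! ### The transform `S` at the critical points -/

theorem integralTransform_chebyshevU_odd {n : ℕ} (hn : 2 ≤ n) {ζ : ℝ} (hζ : ζ ∈ posRoots n) (x : ℝ) :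
    integralTransform (Chebyshev.U ℝ (2 * (n : ℤ) - 1)) ζ x =
      (Chebyshev.U ℝ (2 * (n : ℤ) - 1)).eval ζ *
        (x + 2 / ((2 * n - 1) * (2 * n + 1)) - ζ ^ 2) := by
  have hn2 : (2 : ℝ) ≤ n := by exact_mod_cast hn
  have hN : ((2 * (n : ℝ) - 1) * (2 * n + 1)) ≠ 0 :=
    mul_ne_zero (by linarith) (by linarith)
  set N : ℝ := (2 * (n : ℝ) - 1) * (2 * n + 1) with hNdef
  set p := Chebyshev.U ℝ (2 * (n : ℤ) - 1) with hp
  -- Integration by parts leaves `∫ 2t p`; by the Chebyshev equation `(p - (t-t³)p')' = N t p`.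
  let G : ℝ[X] := p * (C x - X ^ 2) + C (2 / N) * (p - (X - X ^ 3) * derivative p)
  have hG : ∀ t : ℝ, (derivative G).eval t = (derivative p).eval t * (x - t ^ 2) := by
    intro t
    have h := one_sub_sq_mul_eval_derivative_derivU n t
    rw [derivU, ← hp, ← hNdef] at h
    simp only [G, derivative_add, derivative_mul, derivative_sub, derivative_C, derivative_X_pow,
      derivative_X, eval_add, eval_mul, eval_sub, eval_C, eval_pow, eval_X, eval_one, eval_zero]
    field_simp
    push_cast
    linear_combination -2 * t * h
  have h1 : ∫ t in (-ζ)..ζ, (derivative p).eval t * (x - t ^ 2) = G.eval ζ - G.eval (-ζ) := by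
    apply intervalIntegral.integral_eq_sub_of_hasDerivAt
    · intro t _
      rw [← hG]
      exact G.hasDerivAt t
    · apply Continuous.intervalIntegrable
      exact (derivative p).continuous.mul (by fun_prop)
  have h2 : (derivative p).eval ζ = 0 := ((mem_posRoots hn).1 hζ).1
  have h3 : (derivative p).eval (-ζ) = 0 := by
    rw [← h2]
    exact eval_neg_derivU n ζ
  have h4 : p.eval (-ζ) = -p.eval ζ := eval_neg_chebyshevU_odd ζ
  rw [integralTransform, h1]
  simp only [G, eval_add, eval_mul, eval_sub, eval_C, eval_pow, eval_X, h2, h3, h4]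
  ring

theorem prod_integralTransform {n : ℕ} (hn : 2 ≤ n) (x : ℝ) :
    (2 * (n : ℝ) - 1) * 2 ^ (2 * n - 1) * ∏ ζ ∈ posRoots n,
        integralTransform (Chebyshev.U ℝ (2 * (n : ℤ) - 1)) ζ x =
      (∏ ζ ∈ posRoots n, (Chebyshev.U ℝ (2 * (n : ℤ) - 1)).eval ζ) *
        (derivUSqrtReal n).eval (x + 2 / ((2 * n - 1) * (2 * n + 1))) := by
  rw [Finset.prod_congr rfl fun ζ hζ => integralTransform_chebyshevU_odd hn hζ x,
    Finset.prod_mul_distrib, derivUSqrtReal_eq_prod hn]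
  simp only [eval_mul, eval_C, eval_prod, eval_sub, eval_X]
  ring

/-- With `N = (2n-1)(2n+1)` and `P = U'_{2n-1}(√x)`, the integer polynomial
`N ^ (n - 1) * P (x + 2 / N)`. -/
def shiftedDerivUSqrt (n : ℕ) : ℤ[X] :=
  ((derivUSqrt n).scaleRoots ((2 * n - 1) * (2 * n + 1))).comp
    (C ((2 * (n : ℤ) - 1) * (2 * n + 1)) * X + C 2)

/-! ### Existence, uniqueness and roots of `J` -/

theorem map_shiftedDerivUSqrt {n : ℕ} (hn : 2 ≤ n) :
    (shiftedDerivUSqrt n).map (Int.castRingHom ℝ) =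
      C (((2 * (n : ℝ) - 1) * (2 * n + 1)) ^ (n - 1)) *
        taylor (2 / ((2 * (n : ℝ) - 1) * (2 * n + 1))) (derivUSqrtReal n) := by
  have hn2 : (2 : ℝ) ≤ n := by exact_mod_cast hn
  have hN : ((2 * (n : ℝ) - 1) * (2 * n + 1)) ≠ 0 :=
    mul_ne_zero (by linarith) (by linarith)
  refine Polynomial.funext fun x => ?_
  rw [eval_mul, eval_C, taylor_eval, shiftedDerivUSqrt, map_comp, eval_comp, eval_map,
    derivUSqrtReal, eval_map, ← natDegree_derivUSqrt hn]
  have h := scaleRoots_eval₂_mul (p := derivUSqrt n) (Int.castRingHom ℝ)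
    (x + 2 / ((2 * (n : ℝ) - 1) * (2 * n + 1))) ((2 * n - 1) * (2 * n + 1))
  simp only [eq_intCast] at h
  push_cast at h
  rw [mul_add _ x, mul_comm _ (2 / _), div_mul_cancel₀ _ hN] at h
  rw [eval_map, ← h]
  congr 1
  simp

theorem natDegree_shiftedDerivUSqrt {n : ℕ} (hn : 2 ≤ n) :
    (shiftedDerivUSqrt n).natDegree = n - 1 := by
  have hn2 : (2 : ℝ) ≤ n := by exact_mod_cast hn
  have hN : ((2 * (n : ℝ) - 1) * (2 * n + 1)) ≠ 0 :=
    mul_ne_zero (by linarith) (by linarith)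
  rw [← natDegree_map_eq_of_injective (RingHom.injective_int (Int.castRingHom ℝ)),
    map_shiftedDerivUSqrt hn, natDegree_C_mul (pow_ne_zero _ hN), natDegree_taylor,
    natDegree_derivUSqrtReal hn]

theorem leadingCoeff_derivUSqrt {n : ℕ} (hn : 2 ≤ n) :
    (derivUSqrt n).leadingCoeff = (2 * n - 1) * 2 ^ (2 * n - 1) := by
  have h := leadingCoeff_derivUSqrtReal hn
  rw [derivUSqrtReal, leadingCoeff_map_of_injective (RingHom.injective_int _), eq_intCast] at h
  exact_mod_cast h

theorem leadingCoeff_shiftedDerivUSqrt {n : ℕ} (hn : 2 ≤ n) :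
    (shiftedDerivUSqrt n).leadingCoeff =
      ((2 * n - 1) * (2 * n + 1)) ^ (n - 1) * ((2 * n - 1) * 2 ^ (2 * n - 1)) := by
  have hn2 : (2 : ℝ) ≤ n := by exact_mod_cast hn
  have h := congrArg leadingCoeff (map_shiftedDerivUSqrt hn)
  rw [leadingCoeff_map_of_injective (RingHom.injective_int _), leadingCoeff_mul, leadingCoeff_C,
    leadingCoeff_taylor, leadingCoeff_derivUSqrtReal hn, eq_intCast] at h
  exact_mod_cast h

theorem shiftedDerivUSqrt_ne_zero {n : ℕ} (hn : 2 ≤ n) : shiftedDerivUSqrt n ≠ 0 := by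
  rw [← leadingCoeff_ne_zero, leadingCoeff_shiftedDerivUSqrt hn]
  have h1 : (2 * (n : ℤ) - 1) ≠ 0 := by lia
  have h2 : (2 * (n : ℤ) + 1) ≠ 0 := by lia
  positivity

/-- By Gauss's lemma `f²` and `g²` have content `1`, so `q = ±1`; leading coefficients of squares
exclude `-1`. -/
theorem Polynomial.IsPrimitive.eq_or_eq_neg_of_mul_sq_eq {f g : ℤ[X]} (hf : f.IsPrimitive)
    (hg : g.IsPrimitive) {q : ℚ}
    (h : ∀ x : ℝ, (q : ℝ) * (aeval x f) ^ 2 = (aeval x g) ^ 2) : g = f ∨ g = -f := by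
  have h1 : C q.num * f ^ 2 = C (q.den : ℤ) * g ^ 2 := by
    apply Polynomial.map_injective (Int.castRingHom ℝ) (RingHom.injective_int _)
    refine Polynomial.funext fun x => ?_
    have hx := h x
    have hden : (q.den : ℝ) ≠ 0 := by exact_mod_cast q.den_nz
    rw [Rat.cast_def] at hx
    field_simp at hx
    simp only [aeval_def, ← eval_map, algebraMap_int_eq] at hx
    simpa using hx
  have h2 := congrArg content h1
  have hf2 : (f ^ 2).content = 1 := by rw [sq]; exact (hf.mul hf).content_eq_one
  have hg2 : (g ^ 2).content = 1 := by rw [sq]; exact (hg.mul hg).content_eq_one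
  rw [content_C_mul, content_C_mul, hf2, hg2, mul_one, mul_one, ← Int.abs_eq_normalize,
    ← Int.abs_eq_normalize] at h2
  have h3 : f ^ 2 = g ^ 2 := by
    have hd : (C (q.den : ℤ)) ≠ 0 := by
      rw [Ne, C_eq_zero]
      exact_mod_cast q.den_nz
    rcases abs_eq_abs.1 h2 with h4 | h4
    · rw [h4] at h1
      exact mul_left_cancel₀ hd h1
    · rw [h4, C_neg, neg_mul, ← mul_neg] at h1
      have h5 := mul_left_cancel₀ hd h1
      have h6 := congrArg leadingCoeff h5
      rw [leadingCoeff_neg, leadingCoeff_pow, leadingCoeff_pow] at h6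
      have h7 : f.leadingCoeff ≠ 0 := leadingCoeff_ne_zero.2 hf.ne_zero
      nlinarith [sq_nonneg g.leadingCoeff, sq_pos_of_ne_zero h7]
  exact sq_eq_sq_iff_eq_or_eq_neg.1 h3.symm

theorem exists_rat_sq_prod_integralTransform {n : ℕ} (hn : 2 ≤ n) :
    ∃ q : ℚ, q ≠ 0 ∧ ∀ x : ℝ, (∏ ζ ∈ posRoots n,
      integralTransform (Chebyshev.U ℝ (2 * (n : ℤ) - 1)) ζ x) ^ 2 =
        q * (aeval x (shiftedDerivUSqrt n).primPart) ^ 2 := by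
  have hn2 : (2 : ℝ) ≤ n := by exact_mod_cast hn
  have hb : (2 * (n : ℝ) - 1) ≠ 0 := by linarith
  have hN : ((2 * (n : ℝ) - 1) * (2 * n + 1)) ≠ 0 := mul_ne_zero (by linarith) (by linarith)
  have hn0 : (n : ℝ) ≠ 0 := by linarith
  have hc : ((shiftedDerivUSqrt n).content : ℝ) ≠ 0 := by
    exact_mod_cast mt content_eq_zero_iff.1 (shiftedDerivUSqrt_ne_zero hn)
  have hK := prod_eval_chebyshevU_sq hn
  -- The first factor is `(∏ U(ζ))²`; the second squares the ratio of the content to `N^(n-1)` times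
  -- the leading coefficient of `P`.
  obtain ⟨q, hcast⟩ : ∃ q : ℚ, (q : ℝ) = (2 * n) ^ (2 * n - 3) * 2 ^ (2 * n - 1) / (2 * n - 1) ^ (2 * n - 1) *
      ((shiftedDerivUSqrt n).content / (((2 * n - 1) * (2 * n + 1)) ^ (n - 1) *
        ((2 * n - 1) * 2 ^ (2 * n - 1)))) ^ 2 := by
    refine ⟨(2 * n) ^ (2 * n - 3) * 2 ^ (2 * n - 1) / (2 * n - 1) ^ (2 * n - 1) *
      ((shiftedDerivUSqrt n).content / (((2 * n - 1) * (2 * n + 1)) ^ (n - 1) *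
        ((2 * n - 1) * 2 ^ (2 * n - 1)))) ^ 2, ?_⟩
    push_cast
    rfl
  refine ⟨q, ?_, fun x => ?_⟩
  rotate_left
  · rw [hcast, ← hK]
    have h1 := prod_integralTransform hn x
    have h2 := congrArg (eval x) (map_shiftedDerivUSqrt hn)
    rw [eval_mul, eval_C, taylor_eval] at h2
    have h3 := congrArg (aeval x) (eq_C_content_mul_primPart (shiftedDerivUSqrt n))
    rw [map_mul, aeval_C, algebraMap_int_eq, eq_intCast] at h3
    rw [← algebraMap_int_eq, eval_map_algebraMap, h3] at h2
    have h4 : ∏ ζ ∈ posRoots n, integralTransform (Chebyshev.U ℝ (2 * (n : ℤ) - 1)) ζ x =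
        (∏ ζ ∈ posRoots n, (Chebyshev.U ℝ (2 * (n : ℤ) - 1)).eval ζ) *
        ((shiftedDerivUSqrt n).content / (((2 * n - 1) * (2 * n + 1)) ^ (n - 1) *
        ((2 * n - 1) * 2 ^ (2 * n - 1))) * aeval x (shiftedDerivUSqrt n).primPart) := by
      rw [div_mul_eq_mul_div, h2, mul_div_mul_left _ _ (pow_ne_zero _ hN), ← mul_div_assoc, ← h1,
        mul_div_cancel_left₀ _ (leadingCoeff_derivU_pos hn).ne']
    rw [h4, mul_div_cancel_left₀ _ (pow_ne_zero _ hb)]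
    ring
  · rw [← Rat.cast_ne_zero (α := ℝ), hcast]
    have := (leadingCoeff_derivU_pos hn).ne'
    positivity

theorem isJeff_iff {n : ℕ} (hn : 2 ≤ n) (K : ℤ[X]) :
    IsJeff n K ↔ K = (shiftedDerivUSqrt n).primPart ∨ K = -(shiftedDerivUSqrt n).primPart := by
  obtain ⟨q, hq, h⟩ := exists_rat_sq_prod_integralTransform hn
  constructor
  · rintro ⟨_, hK, C, A, hC, hA, hCA⟩
    refine (isPrimitive_primPart _).eq_or_eq_neg_of_mul_sq_eq hK (q := C * q / A)
      fun x => ?_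
    have h1 := hCA x
    have hA' : (A : ℝ) ≠ 0 := by exact_mod_cast hA
    rw [h x] at h1
    push_cast
    field_simp
    linear_combination h1
  · intro hK
    have h1 : ∀ x : ℝ, (aeval x K) ^ 2 = (aeval x (shiftedDerivUSqrt n).primPart) ^ 2 := by
      rcases hK with rfl | rfl <;> simp
    refine ⟨?_, ?_, 1, q, one_ne_zero, hq, fun x => ?_⟩
    · rcases hK with rfl | rfl <;> simp [natDegree_primPart, natDegree_shiftedDerivUSqrt hn]
    · rcases hK with rfl | rfl
      · exact isPrimitive_primPart _
      · exact fun r hr => isPrimitive_primPart _ r (dvd_neg.1 hr)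
    · rw [h1, h]
      simp

theorem C_mul_eq_shiftedDerivUSqrt {n : ℕ} (hn : 2 ≤ n) {J : ℤ[X]} (hJ : IsJeff n J) :
    ∃ c : ℤ, c ≠ 0 ∧ shiftedDerivUSqrt n = C c * J := by
  have hc := mt content_eq_zero_iff.1 (shiftedDerivUSqrt_ne_zero hn)
  rcases (isJeff_iff hn J).1 hJ with rfl | rfl
  · exact ⟨_, hc, eq_C_content_mul_primPart _⟩
  · refine ⟨-(shiftedDerivUSqrt n).content, neg_ne_zero.2 hc, ?_⟩
    rw [C_neg, neg_mul_neg]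
    exact eq_C_content_mul_primPart _

theorem roots_of_isJeff {n : ℕ} (hn : 2 ≤ n) {J : ℤ[X]} (hJ : IsJeff n J) :
    (J.map (Int.castRingHom ℝ)).roots = (posRoots n).val.map
      (fun ζ => ζ ^ 2 - 2 / ((2 * (n : ℝ) - 1) * (2 * (n : ℝ) + 1))) := by
  have hn2 : (2 : ℝ) ≤ n := by exact_mod_cast hn
  have hN : ((2 * (n : ℝ) - 1) * (2 * n + 1)) ≠ 0 := mul_ne_zero (by linarith) (by linarith)
  obtain ⟨c, hc, h⟩ := C_mul_eq_shiftedDerivUSqrt hn hJ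
  have h1 := map_shiftedDerivUSqrt hn
  rw [h, Polynomial.map_mul, map_C, derivUSqrtReal_eq_prod hn, taylor_mul, taylor_C] at h1
  have h2 := congrArg roots h1
  rw [roots_C_mul _ (by simpa using hc), roots_C_mul _ (pow_ne_zero _ hN),
    roots_C_mul _ (leadingCoeff_derivU_pos hn).ne'] at h2
  rw [h2, taylor_apply, prod_comp]
  have h3 : ∀ ζ : ℝ, (X - C (ζ ^ 2)).comp (X + C (2 / ((2 * (n : ℝ) - 1) * (2 * n + 1)))) =
      X - C (ζ ^ 2 - 2 / ((2 * (n : ℝ) - 1) * (2 * n + 1))) := by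
    intro ζ
    rw [sub_comp, X_comp, C_comp, C_sub]
    ring
  simp only [h3]
  have h4 := roots_multiset_prod_X_sub_C ((posRoots n).val.map
    (fun ζ => ζ ^ 2 - 2 / ((2 * (n : ℝ) - 1) * (2 * (n : ℝ) + 1))))
  rw [Multiset.map_map] at h4
  exact h4

/-! ### Coefficients of `P` -/

theorem coeff_derivUSqrt (n j : ℕ) :
    (derivUSqrt n).coeff j = (Chebyshev.U ℤ (2 * (n : ℤ) - 1)).coeff (2 * j + 1) * (2 * j + 1) := by
  rw [derivUSqrt, coeff_contract two_ne_zero, derivU, coeff_derivative, mul_comm j]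
  push_cast
  rfl

theorem coeff_chebyshevU_add_two (m : ℤ) (k : ℕ) :
    ((k : ℤ) + 2) * (k + 1) * (Chebyshev.U ℤ m).coeff (k + 2) =
      ((k + 1) ^ 2 - (m + 1) ^ 2) * (Chebyshev.U ℤ m).coeff k := by
  have h := Chebyshev.iterate_derivative_U_eval_zero_recurrence (R := ℤ) m k
  rw [← coeff_zero_eq_eval_zero, ← coeff_zero_eq_eval_zero, coeff_iterate_derivative,
    coeff_iterate_derivative, zero_add, zero_add, Nat.descFactorial_self, Nat.descFactorial_self,
    nsmul_eq_mul, nsmul_eq_mul, Nat.factorial_succ, Nat.factorial_succ] at h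
  have hk : (k.factorial : ℤ) ≠ 0 := by exact_mod_cast k.factorial_ne_zero
  apply mul_left_cancel₀ hk
  push_cast at h
  linear_combination h

theorem coeff_derivUSqrt_succ (n j : ℕ) :
    ((j : ℤ) + 1) * (2 * j + 1) * (derivUSqrt n).coeff (j + 1) =
      2 * ((j + 1) ^ 2 - n ^ 2) * (derivUSqrt n).coeff j := by
  have h := coeff_chebyshevU_add_two (2 * (n : ℤ) - 1) (2 * j + 1)
  rw [coeff_derivUSqrt, coeff_derivUSqrt, show 2 * (j + 1) + 1 = 2 * j + 1 + 2 by ring]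
  push_cast at h ⊢
  apply mul_left_cancel₀ (two_ne_zero (α := ℤ))
  linear_combination (2 * (j : ℤ) + 1) * h

theorem factorial_mul_coeff_derivUSqrt (n j : ℕ) :
    ((j.factorial : ℤ) * ∏ i ∈ Finset.range j, (2 * (i : ℤ) + 1)) * (derivUSqrt n).coeff j =
      2 ^ j * (∏ i ∈ Finset.range j, (((i : ℤ) + 1) ^ 2 - n ^ 2)) * (derivUSqrt n).coeff 0 := by
  induction j with
  | zero => simp
  | succ j ih =>
    rw [Finset.prod_range_succ, Finset.prod_range_succ, Nat.factorial_succ]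
    push_cast
    have h := coeff_derivUSqrt_succ n j
    linear_combination (j.factorial : ℤ) * (∏ i ∈ Finset.range j, (2 * (i : ℤ) + 1)) * h +
      2 * (((j : ℤ) + 1) ^ 2 - n ^ 2) * ih

/-- In the closed form for the `j`-th coefficient the numerator has `2^j`, while `j!` has 2-adic
valuation below `j` and the remaining denominator is odd. -/
theorem two_pow_succ_dvd_coeff_derivUSqrt {n s : ℕ} (h0 : (2 : ℤ) ^ s ∣ (derivUSqrt n).coeff 0)
    {j : ℕ} (hj : 1 ≤ j) : (2 : ℤ) ^ (s + 1) ∣ (derivUSqrt n).coeff j := by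
  obtain ⟨b, o, ho, hb⟩ := Nat.exists_eq_two_pow_mul_odd j.factorial_ne_zero
  have hbj : b < j := by
    by_contra! hcon
    have h1 := Nat.emultiplicity_two_factorial_lt (n := j) (by lia)
    rw [emultiplicity_lt_iff_not_dvd] at h1
    exact h1 (hb ▸ Dvd.dvd.mul_right (pow_dvd_pow 2 hcon) o)
  obtain ⟨y, hy⟩ := h0
  have h := factorial_mul_coeff_derivUSqrt n j
  rw [hb, hy] at h
  set Q := ∏ i ∈ Finset.range j, (2 * (i : ℤ) + 1) with hQ
  have hQodd : Odd Q := by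
    rw [hQ]
    exact Finset.prod_induction _ Odd (fun _ _ ha hb => ha.mul hb) odd_one
      fun i _ => ⟨i, rfl⟩
  have hoQ : Odd ((o : ℤ) * Q) := (Int.odd_coe_nat o |>.2 ho).mul hQodd
  obtain ⟨t, ht⟩ := Nat.exists_eq_add_of_lt hbj
  have h2 : ((o : ℤ) * Q) * (derivUSqrt n).coeff j = 2 ^ (s + 1) *
      (2 ^ t * (∏ i ∈ Finset.range j, (((i : ℤ) + 1) ^ 2 - n ^ 2)) * y) := by
    have h3 : (2 : ℤ) ^ b ≠ 0 := by positivity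
    apply mul_left_cancel₀ h3
    have h4 : (2 : ℤ) ^ j = 2 ^ b * 2 ^ t * 2 := by rw [← pow_add, ← pow_succ, ← ht]
    rw [h4] at h
    push_cast at h
    rw [pow_succ]
    linear_combination h
  have h5 : IsCoprime ((2 : ℤ) ^ (s + 1)) (o * Q) :=
    IsCoprime.pow_left (Int.isCoprime_two_left.2 hoQ)
  exact h5.dvd_of_dvd_mul_left ⟨_, h2⟩

theorem sq_coeff_zero_derivUSqrt (n : ℕ) : (derivUSqrt n).coeff 0 ^ 2 = (2 * (n : ℤ)) ^ 2 := by
  have h := sq_eval_derivU_zero n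
  rw [← map_derivU, ← coeff_zero_eq_eval_zero, coeff_map, eq_intCast] at h
  have h2 : (derivUSqrt n).coeff 0 = (derivU ℤ n).coeff 0 := by
    rw [derivUSqrt, coeff_contract two_ne_zero, zero_mul]
  rw [h2]
  exact_mod_cast h

/-! ### Primes dividing `2N`: `J` is constant mod `p` -/

theorem dvd_coeff_linear_pow (N a : ℤ) (i : ℕ) {k : ℕ} (hk : 1 ≤ k) :
    N ∣ ((C N * X + C a) ^ i).coeff k := by
  have h : C N ∣ (C N * X + C a) ^ i - (C a) ^ i := by
    refine Dvd.dvd.trans ?_ (sub_dvd_pow_sub_pow _ _ i)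
    rw [add_sub_cancel_right]
    exact dvd_mul_right _ _
  have h2 := (C_dvd_iff_dvd_coeff _ _).1 h k
  rwa [coeff_sub, ← C_pow, coeff_C_of_ne_zero (by lia), sub_zero] at h2

theorem shiftedDerivUSqrt_eq_sum {n : ℕ} (hn : 2 ≤ n) :
    shiftedDerivUSqrt n = ∑ i ∈ Finset.range n, C ((derivUSqrt n).coeff i *
      ((2 * n - 1) * (2 * n + 1)) ^ (n - 1 - i)) *
        (C ((2 * (n : ℤ) - 1) * (2 * n + 1)) * X + C 2) ^ i := by
  rw [shiftedDerivUSqrt, comp, eval₂_eq_sum_range, natDegree_scaleRoots, natDegree_derivUSqrt hn,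
    show n - 1 + 1 = n by lia]
  simp only [coeff_scaleRoots, natDegree_derivUSqrt hn]

theorem coeff_shiftedDerivUSqrt {n : ℕ} (hn : 2 ≤ n) (k : ℕ) :
    (shiftedDerivUSqrt n).coeff k = ∑ i ∈ Finset.range n, (derivUSqrt n).coeff i *
      ((2 * n - 1) * (2 * n + 1)) ^ (n - 1 - i) *
        ((C ((2 * (n : ℤ) - 1) * (2 * n + 1)) * X + C 2) ^ i).coeff k := by
  rw [shiftedDerivUSqrt_eq_sum hn, finsetSum_coeff]
  simp only [coeff_C_mul]

theorem coeff_zero_shiftedDerivUSqrt {n : ℕ} (hn : 2 ≤ n) :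
    (shiftedDerivUSqrt n).coeff 0 = ∑ i ∈ Finset.range n, (derivUSqrt n).coeff i *
      ((2 * n - 1) * (2 * n + 1)) ^ (n - 1 - i) * 2 ^ i := by
  rw [coeff_shiftedDerivUSqrt hn]
  simp [coeff_zero_eq_eval_zero]

theorem coeff_derivUSqrt_sub_one {n : ℕ} (hn : 2 ≤ n) :
    (derivUSqrt n).coeff (n - 1) = (2 * n - 1) * 2 ^ (2 * n - 1) := by
  rw [← leadingCoeff_derivUSqrt hn, leadingCoeff, natDegree_derivUSqrt hn]

theorem coeff_derivUSqrt_sub_two {n : ℕ} (hn : 2 ≤ n) :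
    (derivUSqrt n).coeff (n - 2) = -((n - 1) * (2 * n - 3) * 2 ^ (2 * n - 2)) := by
  have h := coeff_derivUSqrt_succ n (n - 2)
  rw [show n - 2 + 1 = n - 1 by lia, coeff_derivUSqrt_sub_one hn, Nat.cast_sub hn,
    show 2 * n - 1 = 2 * n - 2 + 1 by lia, pow_succ] at h
  push_cast at h
  have hb : 2 * (2 * (n : ℤ) - 1) ≠ 0 := by lia
  apply mul_left_cancel₀ hb
  linear_combination h

/-- Avoids computing the content `c`: if the `k`-th coefficient of `F` has larger `p`-adic valuation
than the constant one, a factor `p` survives division by `c`. -/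
theorem dvd_coeff_of_C_mul_eq {p : ℕ} (hp : p.Prime) {F J : ℤ[X]} {c M u : ℤ} (hM : M ≠ 0)
    (hF : F = C c * J) (h0 : F.coeff 0 = M * u) (hu : ¬ (p : ℤ) ∣ u) {k : ℕ}
    (hk : M * p ∣ F.coeff k) : (p : ℤ) ∣ J.coeff k := by
  obtain ⟨w, hw⟩ := hk
  rw [hF, coeff_C_mul] at h0 hw
  have h : J.coeff k * u = p * (w * J.coeff 0) := by
    apply mul_left_cancel₀ hM
    linear_combination J.coeff 0 * hw - J.coeff k * h0
  exact ((Nat.prime_iff_prime_int.1 hp).dvd_or_dvd ⟨_, h⟩).resolve_right hu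

theorem two_dvd_coeff_of_isJeff {n : ℕ} (hn : 2 ≤ n) {J : ℤ[X]} (hJ : IsJeff n J) {k : ℕ}
    (hk : 1 ≤ k) : ((2 : ℕ) : ℤ) ∣ J.coeff k := by
  obtain ⟨c, -, hF⟩ := C_mul_eq_shiftedDerivUSqrt hn hJ
  have h0 : (derivUSqrt n).coeff 0 ≠ 0 := by
    intro h
    have := sq_coeff_zero_derivUSqrt n
    rw [h] at this
    have : 2 * (n : ℤ) = 0 := by simpa using this.symm
    lia
  obtain ⟨s, o, ho, hs⟩ := Nat.exists_eq_two_pow_mul_odd (Int.natAbs_ne_zero.2 h0)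
  have hdvd : (2 : ℤ) ^ s ∣ (derivUSqrt n).coeff 0 := by
    rw [← Int.natAbs_dvd_natAbs, hs, Int.natAbs_pow]
    exact dvd_mul_right _ _
  have hdvd' : ¬ (2 : ℤ) ^ (s + 1) ∣ (derivUSqrt n).coeff 0 := by
    rw [← Int.natAbs_dvd_natAbs, hs, Int.natAbs_pow, pow_succ]
    intro h
    have := Nat.dvd_of_mul_dvd_mul_left (by positivity) h
    exact (Nat.not_even_iff_odd.2 ho) (even_iff_two_dvd.2 this)
  obtain ⟨y, hy⟩ := hdvd
  have hyodd : Odd y := by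
    rw [← Int.not_even_iff_odd, even_iff_two_dvd]
    rintro ⟨z, rfl⟩
    exact hdvd' ⟨z, by rw [hy]; ring⟩
  have hrest : (2 : ℤ) ^ (s + 1) ∣ ∑ i ∈ Finset.Ico 1 n, (derivUSqrt n).coeff i *
      ((2 * n - 1) * (2 * n + 1)) ^ (n - 1 - i) * 2 ^ i :=
    Finset.dvd_sum fun i hi => ((two_pow_succ_dvd_coeff_derivUSqrt ⟨y, hy⟩
      (Finset.mem_Ico.1 hi).1).mul_right _).mul_right _
  obtain ⟨r, hr⟩ := hrest
  have hF0 := coeff_zero_shiftedDerivUSqrt hn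
  rw [Finset.range_eq_Ico, Finset.sum_eq_sum_Ico_succ_bot (by lia), hr, hy] at hF0
  -- `2^s` exactly divides the constant coefficient of `P`, and `N` is odd, so only the term `i = 0`
  -- matters mod `2^(s+1)`.
  refine dvd_coeff_of_C_mul_eq Nat.prime_two (M := 2 ^ s)
    (u := y * ((2 * n - 1) * (2 * n + 1)) ^ (n - 1 - 0) + 2 * r) (by positivity) hF
    (by rw [hF0]; ring) ?_ ?_
  · have h1 : Odd (((2 * (n : ℤ) - 1) * (2 * n + 1)) ^ (n - 1 - 0)) :=
      Odd.pow (Odd.mul ⟨n - 1, by ring⟩ ⟨n, rfl⟩)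
    have h2 := (hyodd.mul h1).add_even (even_two_mul r)
    rw [Nat.cast_ofNat, ← even_iff_two_dvd, Int.not_even_iff_odd]
    exact h2
  · rw [Nat.cast_ofNat, ← pow_succ, coeff_shiftedDerivUSqrt hn]
    refine Finset.dvd_sum fun i _ => ?_
    rcases Nat.eq_zero_or_pos i with rfl | hi
    · rw [pow_zero, coeff_one, if_neg (by lia), mul_zero]
      exact dvd_zero _
    · exact ((two_pow_succ_dvd_coeff_derivUSqrt ⟨y, hy⟩ hi).mul_right _).mul_right _

theorem not_dvd_two_pow_of_odd_prime {p : ℕ} (hp : p.Prime) (hp2 : p ≠ 2) (m : ℕ) :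
    ¬ (p : ℤ) ∣ 2 ^ m := by
  intro h
  have h1 : p ∣ 2 ^ m := by exact_mod_cast h
  exact hp2 ((Nat.prime_dvd_prime_iff_eq hp Nat.prime_two).1 (hp.dvd_of_dvd_pow h1))

theorem not_dvd_two_mul_sub_one_of_dvd {p n : ℕ} (hp : p.Prime) (hp2 : p ≠ 2)
    (h : (p : ℤ) ∣ 2 * n + 1) : ¬ (p : ℤ) ∣ 2 * n - 1 := by
  intro h2
  have h3 := dvd_sub h h2
  rw [show (2 * (n : ℤ) + 1) - (2 * n - 1) = 2 ^ 1 by ring] at h3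
  exact not_dvd_two_pow_of_odd_prime hp hp2 1 h3

theorem dvd_coeff_of_isJeff_of_dvd_add_one {n : ℕ} (hn : 2 ≤ n) {J : ℤ[X]} (hJ : IsJeff n J)
    {p : ℕ} (hp : p.Prime) (hp2 : p ≠ 2) (hpn : (p : ℤ) ∣ 2 * n + 1) {k : ℕ} (hk : 1 ≤ k) :
    (p : ℤ) ∣ J.coeff k := by
  obtain ⟨c, -, hF⟩ := C_mul_eq_shiftedDerivUSqrt hn hJ
  have hpN : (p : ℤ) ∣ (2 * n - 1) * (2 * n + 1) := hpn.mul_left _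
  refine dvd_coeff_of_C_mul_eq hp (M := 1) one_ne_zero hF (one_mul _).symm ?_ ?_
  -- Only the top term lacks a factor `N`; it is `2n-1` times a power of `2`.
  · rw [coeff_zero_shiftedDerivUSqrt hn, ← Nat.sub_add_cancel (show 1 ≤ n by lia),
      Finset.sum_range_succ, Nat.sub_add_cancel (show 1 ≤ n by lia), Nat.sub_self, pow_zero,
      mul_one, coeff_derivUSqrt_sub_one hn, dvd_add_right]
    · intro h
      have hp' := Nat.prime_iff_prime_int.1 hp
      rcases hp'.dvd_or_dvd h with h | h
      · rcases hp'.dvd_or_dvd h with h | h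
        · exact not_dvd_two_mul_sub_one_of_dvd hp hp2 hpn h
        · exact not_dvd_two_pow_of_odd_prime hp hp2 _ h
      · exact not_dvd_two_pow_of_odd_prime hp hp2 _ h
    · refine Finset.dvd_sum fun i hi => ?_
      rw [Finset.mem_range] at hi
      exact ((dvd_pow hpN (by lia)).mul_left _).mul_right _
  · rw [one_mul, coeff_shiftedDerivUSqrt hn]
    exact Finset.dvd_sum fun i _ => (hpN.trans (dvd_coeff_linear_pow _ _ _ hk)).mul_left _

theorem dvd_coeff_of_isJeff_of_dvd_sub_one {n : ℕ} (hn : 2 ≤ n) {J : ℤ[X]} (hJ : IsJeff n J)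
    {p : ℕ} (hp : p.Prime) (hp2 : p ≠ 2) (hpn : (p : ℤ) ∣ 2 * n - 1) {k : ℕ} (hk : 1 ≤ k) :
    (p : ℤ) ∣ J.coeff k := by
  obtain ⟨c, -, hF⟩ := C_mul_eq_shiftedDerivUSqrt hn hJ
  have hbN : (2 * (n : ℤ) - 1) ∣ (2 * n - 1) * (2 * n + 1) := dvd_mul_right _ _
  have hrest : ((2 * (n : ℤ) - 1)) ^ 2 ∣ ∑ i ∈ Finset.range (n - 2), (derivUSqrt n).coeff i *
      ((2 * n - 1) * (2 * n + 1)) ^ (n - 1 - i) * 2 ^ i := by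
    refine Finset.dvd_sum fun i hi => ?_
    rw [Finset.mem_range] at hi
    exact (((pow_dvd_pow_of_dvd hbN 2).trans (pow_dvd_pow _ (by lia))).mul_left _).mul_right _
  obtain ⟨r, hr⟩ := hrest
  have hF0 := coeff_zero_shiftedDerivUSqrt hn
  have hrange : ∀ f : ℕ → ℤ, ∑ i ∈ Finset.range n, f i =
      ∑ i ∈ Finset.range (n - 2), f i + f (n - 2) + f (n - 1) := by
    intro f
    obtain ⟨m, rfl⟩ := Nat.exists_eq_add_of_le' hn
    simp [Finset.sum_range_succ]
  rw [hrange, hr, coeff_derivUSqrt_sub_one hn, coeff_derivUSqrt_sub_two hn, Nat.sub_self, pow_zero,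
    show n - 1 - (n - 2) = 1 by lia, show 2 * n - 1 = 2 * n - 2 + 1 by lia,
    show n - 1 = n - 2 + 1 by lia] at hF0
  -- Mod `(2n-1)²` only the two top terms survive. Both contain `2n-1`, and `u` comes from
  -- `(n-1)(2n-3)(2n+1) = (2n-1)(2n²-3n-1) + 2`.
  refine dvd_coeff_of_C_mul_eq hp (M := 2 * n - 1)
    (u := (2 * n - 1) * (r - 2 ^ (2 * n - 2) * 2 ^ (n - 2) * (2 * n ^ 2 - 3 * n - 1)) +
      2 ^ (2 * n - 2 + (n - 2) + 1)) (by lia) hF ?_ ?_ ?_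
  · rw [hF0, pow_succ _ (2 * n - 2 + (n - 2)), pow_add]
    ring
  · rw [dvd_add_right (hpn.mul_right _)]
    exact not_dvd_two_pow_of_odd_prime hp hp2 _
  · have h2 : (2 * (n : ℤ) - 1) * p ∣ (2 * n - 1) * (2 * n - 1) := mul_dvd_mul_left _ hpn
    refine h2.trans ?_
    rw [coeff_shiftedDerivUSqrt hn]
    refine Finset.dvd_sum fun i hi => ?_
    refine mul_dvd_mul ?_ (hbN.trans (dvd_coeff_linear_pow _ _ _ hk))
    rcases Nat.lt_or_ge i (n - 1) with h | h
    · exact (hbN.trans (dvd_pow_self _ (by lia))).mul_left _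
    · have : i = n - 1 := by have := Finset.mem_range.1 hi; lia
      rw [this, coeff_derivUSqrt_sub_one hn]
      exact (dvd_mul_right _ _).mul_right _

theorem dvd_discr_of_isJeff {n : ℕ} (hn : 3 ≤ n) {J : ℤ[X]} (hJ : IsJeff n J) {p : ℕ}
    (hp : p.Prime) (h : p = 2 ∨ (p : ℤ) ∣ 2 * n - 1 ∨ (p : ℤ) ∣ 2 * n + 1) :
    (p : ℤ) ∣ J.discr := by
  have hn2 : 2 ≤ n := by lia
  refine dvd_discr_of_forall_dvd_coeff (by rw [hJ.1]; lia) fun k hk => ?_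
  by_cases hp2 : p = 2
  · subst hp2
    exact two_dvd_coeff_of_isJeff hn2 hJ hk
  · rcases h.resolve_left hp2 with h | h
    · exact dvd_coeff_of_isJeff_of_dvd_sub_one hn2 hJ hp hp2 h hk
    · exact dvd_coeff_of_isJeff_of_dvd_add_one hn2 hJ hp hp2 h hk

/-! ### Primes not dividing `2N`, and the final comparison -/

/-- Translation preserves the discriminant and scaling multiplies it by powers of `c` and `N`. Here
`p ∤ c` because `c` divides the leading coefficient `N^(n-1) (2n-1) 2^(2n-1)`. -/
theorem dvd_discr_iff_of_isJeff {n : ℕ} (hn : 2 ≤ n) {J : ℤ[X]} (hJ : IsJeff n J) {p : ℕ}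
    (hp : p.Prime) (hp2 : p ≠ 2) (hb : ¬ (p : ℤ) ∣ 2 * n - 1) (hc : ¬ (p : ℤ) ∣ 2 * n + 1) :
    (p : ℤ) ∣ J.discr ↔ (p : ℤ) ∣ (derivUSqrt n).discr := by
  have hp' := Nat.prime_iff_prime_int.1 hp
  have hN : ¬ (p : ℤ) ∣ (2 * n - 1) * (2 * n + 1) := fun h =>
    (hp'.dvd_or_dvd h).elim hb hc
  obtain ⟨c, hc0, hF⟩ := C_mul_eq_shiftedDerivUSqrt hn hJ
  have hpc : ¬ (p : ℤ) ∣ c := by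
    intro h
    have h1 := congrArg leadingCoeff hF
    rw [leadingCoeff_shiftedDerivUSqrt hn, leadingCoeff_mul, leadingCoeff_C] at h1
    have h2 := h.mul_right J.leadingCoeff
    rw [← h1] at h2
    rcases hp'.dvd_or_dvd h2 with h2 | h2
    · exact hN (hp'.dvd_of_dvd_pow h2)
    · exact (hp'.dvd_or_dvd h2).elim hb (not_dvd_two_pow_of_odd_prime hp hp2 _)
  have hnR : (2 : ℝ) ≤ n := by exact_mod_cast hn
  have hNR : ((2 * (n : ℝ) - 1) * (2 * n + 1)) ≠ 0 := mul_ne_zero (by linarith) (by linarith)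
  have hinj := RingHom.injective_int (Int.castRingHom ℝ)
  have hJdeg : 0 < J.natDegree := by rw [hJ.1]; lia
  have hPdeg : 0 < (derivUSqrtReal n).natDegree := by rw [natDegree_derivUSqrtReal hn]; lia
  have h1 := congrArg discr (map_shiftedDerivUSqrt hn)
  rw [hF, Polynomial.map_mul, map_C, discr_C_mul (by rwa [natDegree_map_eq_of_injective hinj])
      (by simpa using hc0),
    discr_C_mul (by rwa [natDegree_taylor]) (pow_ne_zero _ hNR), natDegree_taylor,
    discr_taylor hPdeg, natDegree_map_eq_of_injective hinj, hJ.1, natDegree_derivUSqrtReal hn,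
    derivUSqrtReal, discr_map_of_injective hinj hJdeg,
    discr_map_of_injective hinj (by rw [natDegree_derivUSqrt hn]; lia)] at h1
  simp only [eq_intCast] at h1
  have h2 : c ^ (2 * (n - 1 - 1)) * J.discr =
      (((2 * (n : ℤ) - 1) * (2 * n + 1)) ^ (n - 1)) ^ (2 * (n - 1 - 1)) * (derivUSqrt n).discr := by
    exact_mod_cast h1
  constructor
  · intro h
    have h3 := h.mul_left (c ^ (2 * (n - 1 - 1)))
    rw [h2] at h3
    exact (hp'.dvd_or_dvd h3).resolve_left fun h => hN (hp'.dvd_of_dvd_pow (hp'.dvd_of_dvd_pow h))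
  · intro h
    have h3 := h.mul_left ((((2 * (n : ℤ) - 1) * (2 * n + 1)) ^ (n - 1)) ^ (2 * (n - 1 - 1)))
    rw [← h2] at h3
    exact (hp'.dvd_or_dvd h3).resolve_left fun h => hpc (hp'.dvd_of_dvd_pow h)

theorem discr_derivUSqrt_eq_of_three_le {n : ℕ} (hn : 3 ≤ n) :
    (derivUSqrt n).discr = 3 * (2 * (n : ℤ) + 1) ^ (n - 2) * ((2 * n - 1) * n) ^ (n - 3) *
      2 ^ (2 * n ^ 2 - 3 * n - 1) := by
  have h := discr_derivUSqrt_mul (n := n) (by lia)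
  have h0 : ((2 * (n : ℤ) - 1) * n) ≠ 0 := mul_ne_zero (by lia) (by lia)
  apply mul_right_cancel₀ h0
  rw [h, mul_assoc (2 * (n : ℤ) + 1), mul_pow, show n - 2 = n - 3 + 1 by lia, pow_succ (_ * _)]
  ring

theorem prime_dvd_discr_derivUSqrt_iff {n : ℕ} (hn : 3 ≤ n) {p : ℕ} (hp : p.Prime) :
    (p : ℤ) ∣ (derivUSqrt n).discr ↔ p = 2 ∨ p = 3 ∨ (p : ℤ) ∣ 2 * n + 1 ∨
      (n ≠ 3 ∧ ((p : ℤ) ∣ n ∨ (p : ℤ) ∣ 2 * n - 1)) := by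
  have hp' := Nat.prime_iff_prime_int.1 hp
  have hE : 2 * n ^ 2 - 3 * n - 1 ≠ 0 := by
    have : 3 * n + 1 < 2 * n ^ 2 := by nlinarith
    lia
  have h3 : (p : ℤ) ∣ 3 ↔ p = 3 := by
    rw [← Nat.prime_dvd_prime_iff_eq hp Nat.prime_three]
    exact_mod_cast Iff.rfl
  have h2 : (p : ℤ) ∣ 2 ↔ p = 2 := by
    rw [← Nat.prime_dvd_prime_iff_eq hp Nat.prime_two]
    exact_mod_cast Iff.rfl
  rw [discr_derivUSqrt_eq_of_three_le hn, hp'.dvd_mul, hp'.dvd_mul, hp'.dvd_mul,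
    hp'.dvd_pow_iff_dvd (by lia), hp'.dvd_pow_iff_dvd hE, h3, h2]
  by_cases h : n = 3
  · subst h
    have : ¬ (p : ℤ) ∣ 1 := hp'.not_dvd_one
    simp only [Nat.sub_self, pow_zero]
    tauto
  · rw [hp'.dvd_pow_iff_dvd (by lia), hp'.dvd_mul]
    tauto

theorem prime_dvd_discr_iff_of_isJeff {n : ℕ} (hn : 3 ≤ n) {J : ℤ[X]} (hJ : IsJeff n J) {p : ℕ}
    (hp : p.Prime) : (p : ℤ) ∣ J.discr ↔
      p = 2 ∨ p = 3 ∨ p ∣ n ∨ (p : ℤ) ∣ 2 * (n : ℤ) - 1 ∨ p ∣ 2 * n + 1 := by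
  have hcast : p ∣ 2 * n + 1 ↔ (p : ℤ) ∣ 2 * n + 1 := by
    rw [← Int.natCast_dvd_natCast]
    push_cast
    rfl
  rw [hcast]
  by_cases h : p = 2 ∨ (p : ℤ) ∣ 2 * n - 1 ∨ (p : ℤ) ∣ 2 * n + 1
  · have := dvd_discr_of_isJeff hn hJ hp h
    tauto
  · push Not at h
    rw [dvd_discr_iff_of_isJeff (by lia) hJ hp h.1 h.2.1 h.2.2, prime_dvd_discr_derivUSqrt_iff hn hp,
      Int.natCast_dvd_natCast]
    -- For `n = 3` the factor `n` is absent from `Disc P`, but the constant `3` supplies its only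
    -- prime.
    have h3 : n = 3 → p ∣ n → p = 3 := by
      rintro rfl h
      exact (Nat.prime_dvd_prime_iff_eq hp Nat.prime_three).1 h
    tauto

theorem discr_eq_one_of_isJeff_two {J : ℤ[X]} (hJ : IsJeff 2 J) : J.discr = 1 := by
  apply discr_of_degree_eq_one
  have := hJ.1
  rw [← Nat.cast_one, degree_eq_iff_natDegree_eq_of_pos one_pos, this]
  rfl

theorem discr_derivUSqrt_two : (derivUSqrt 2).discr = 1 := by
  apply discr_of_degree_eq_one
  rw [← Nat.cast_one, degree_eq_iff_natDegree_eq_of_pos one_pos, natDegree_derivUSqrt le_rfl]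
  rfl

end

theorem theorem2 (n : ℕ) (hn : 2 ≤ n) :
    -- the Jeff polynomial exists and is unique up to sign
    (∃ J : ℤ[X], ∀ K : ℤ[X], IsJeff n K ↔ K = J ∨ K = -J) ∧
    -- the discriminant of `U'_{2n-1}(√x)`
    ((derivUSqrt n).discr : ℚ) =
      3 * (2 * (n : ℚ) + 1) ^ ((n : ℤ) - 2) * (2 * (n : ℚ) - 1) ^ ((n : ℤ) - 3) *
        (n : ℚ) ^ ((n : ℤ) - 3) * (2 : ℚ) ^ (2 * (n : ℤ) ^ 2 - 3 * (n : ℤ) - 1) ∧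
    ∀ J : ℤ[X], IsJeff n J →
      -- the roots of `J`
      (J.map (Int.castRingHom ℝ)).roots =
        (posRoots n).val.map
          (fun ζ => ζ ^ 2 - 2 / ((2 * (n : ℝ) - 1) * (2 * (n : ℝ) + 1))) ∧
      -- the two discriminants have the same prime factors
      (n ≠ 3 → ∀ p : ℕ, p.Prime → ((p : ℤ) ∣ J.discr ↔ (p : ℤ) ∣ (derivUSqrt n).discr)) ∧
      -- these are 2, 3 and the primes of `n`, `2n - 1`, `2n + 1`
      (3 ≤ n → ∀ p : ℕ, p.Prime →
        ((p : ℤ) ∣ J.discr ↔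
          p = 2 ∨ p = 3 ∨ p ∣ n ∨ (p : ℤ) ∣ 2 * (n : ℤ) - 1 ∨ p ∣ 2 * n + 1)) := by
  refine ⟨⟨_, isJeff_iff hn⟩, discr_derivUSqrt_eq hn, fun J hJ =>
    ⟨roots_of_isJeff hn hJ, fun hn3 p hp => ?_, fun hn3 p hp =>
      prime_dvd_discr_iff_of_isJeff hn3 hJ hp⟩⟩
  rcases Nat.eq_or_lt_of_le hn with rfl | hn2
  · rw [discr_eq_one_of_isJeff_two hJ, discr_derivUSqrt_two]
  · have hcast : p ∣ 2 * n + 1 ↔ (p : ℤ) ∣ 2 * n + 1 := by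
      rw [← Int.natCast_dvd_natCast]
      push_cast
      rfl
    rw [prime_dvd_discr_iff_of_isJeff hn2 hJ hp, prime_dvd_discr_derivUSqrt_iff hn2 hp, hcast,
      Int.natCast_dvd_natCast]
    tauto
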